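/- Consider an $n\times n$ input-queued switch in discrete time. Its state is the matrix $q(t)\in\mathbb{Z}_{\ge 0}^{n\times n}$ of queue lengths, and $$q(t+1)=[\,q(t)+a(t)-s(t)\,]^+\quad\text{(entrywise)}.$$ The arrival matrices $a(t)$ are i.i.d. over time with independent entries in $\{0,1,\dots,a_{\max}\}$. The schedule $s(t)$ is a permutation matrix chosen by the MaxWeight rule: given $q(t)$, and independently of $a(t)$, it is chosen among the permutation matrices that maximize $\langle q(t),s\rangle=\sum_{ij}q_{ij}(t)s_{ij}$; ties may be broken in any (possibly random) way depending only on $q(t)$. Let $\mathcal{C}$ be the set of nonnegative $n\times n$ matrices with all row and column sums at most $1$. Let $0\le n_1,n_2<n$, and let $\mathcal{F}_{n_1n_2}$ be the set of $x\in\mathcal{C}$ whose first $n_1$ row sums and first $n_2$ column sums equal $1$. Let $\nu$ lie in the relative interior of $\mathcal{F}_{n_1n_2}$, with $\nu_{ij}>0$ for all $i,j$. For each $0<\epsilon<1$ consider such a switch under MaxWeight whose arrivals have mean matrix $\lambda^{(\epsilon)}=(1-\epsilon)\nu$ and variances $(\sigma^{(\epsilon)}_{ij})^2$, where $a_{\max}$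 does not depend on $\epsilon$ and $(\sigma^{(\epsilon)}_{ij})^2\to\sigma_{ij}^2$ as $\epsilon\downarrow 0$ for all $i,j$. Let $\overline{q}^{(\epsilon)}$ be distributed according to a stationary distribution of the Markov chain of queue lengths. Then $\mathbb{E}[\overline{q}^{(\epsilon)}_{ij}]<\infty$ for all $i,j$ and all $0<\epsilon<1$, $$\lim_{\epsilon\downarrow 0}\epsilon\,\mathbb{E}\Big[\sum_{ij}\overline{q}^{(\epsilon)}_{ij}\Big]=\frac12\sum_{ij}\sigma_{ij}^2\,\zeta_{ij},$$ and $$\lim_{\epsilon\downarrow 0}\epsilon\,\mathbb{E}\big[\overline{q}^{(\epsilon)}_{ij}\big]=0\quad\text{for all } i>n_1,\ j>n_2,$$ where $$\zeta_{ij}=\begin{cases}2-\dfrac{2n-n_1-n_2}{n^2-n_1n_2}& i\le n_1,\ j\le n_2,\\[1ex] 1+\dfrac{n_2}{n^2-n_1n_2}& i\le n_1,\ j>n_2,\\[1ex] 1+\dfrac{n_1}{n^2-n_1n_2}& i>n_1,\ j\le n_2,\\[1ex] 0& i>n_1,\ j>n_2.\end{cases}$$ -/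

import Mathlib

open MeasureTheory ProbabilityTheory Filter Topology
open scoped ENNReal

/-- Queue lengths of an `n × n` input-queued switch: `q i j` is the number of packets waiting at
input port `i` for output port `j`. -/
abbrev QueueState (n : ℕ) := Fin n → Fin n → ℕ

/-- The capacity region: nonnegative rate matrices whose row sums and column sums are at most 1. -/
def capacityRegion (n : ℕ) : Set (Fin n → Fin n → ℝ) :=
  {x | (∀ i j, 0 ≤ x i j) ∧ (∀ i, ∑ j, x i j ≤ 1) ∧ (∀ j, ∑ i, x i j ≤ 1)}

/-- The face of the capacity region on which the first `n₁` input ports (rows) and the first `n₂`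
output ports (columns) are saturated. -/
def saturatedFace (n n₁ n₂ : ℕ) : Set (Fin n → Fin n → ℝ) :=
  {x | x ∈ capacityRegion n ∧ (∀ i : Fin n, (i : ℕ) < n₁ → ∑ j, x i j = 1) ∧
    (∀ j : Fin n, (j : ℕ) < n₂ → ∑ i, x i j = 1)}

/-- A maximal schedule matches input ports with output ports bijectively, so it is a permutation
`s`; this is its `0`-`1` matrix. -/
def scheduleMatrix {n : ℕ} (s : Equiv.Perm (Fin n)) : QueueState n :=
  fun i j => if s i = j then 1 else 0

/-- The weight `⟨q, s⟩` of the schedule `s` at queue lengths `q`. -/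
def scheduleWeight {n : ℕ} (q : QueueState n) (s : Equiv.Perm (Fin n)) : ℕ :=
  ∑ i, ∑ j, q i j * scheduleMatrix s i j

/-- `s` is a schedule of maximum weight at queue lengths `q`. -/
def IsMaxWeight {n : ℕ} (q : QueueState n) (s : Equiv.Perm (Fin n)) : Prop :=
  ∀ s' : Equiv.Perm (Fin n), scheduleWeight q s' ≤ scheduleWeight q s

/-- A (possibly randomized) scheduling rule, which picks a schedule according to a law depending
on the current queue lengths, is a MaxWeight rule if it only ever picks schedules of maximum
weight. Ties may be broken in any way, in particular uniformly at random. -/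
def IsMaxWeightRule {n : ℕ} (rule : QueueState n → PMF (Equiv.Perm (Fin n))) : Prop :=
  ∀ q, ∀ s ∈ (rule q).support, IsMaxWeight q s

/-- Queue lengths in the next time slot, `[q + a - s]⁺` entrywise (subtraction of natural numbers
is truncated at zero). -/
def nextQueue {n : ℕ} (q a : QueueState n) (s : Equiv.Perm (Fin n)) : QueueState n :=
  fun i j => q i j + a i j - scheduleMatrix s i j

/-- The law of the matrix of arrivals in one time slot: independent entries, where the entry
`(i, j)` has law `arr i j`. -/
noncomputable def arrivalLaw {n : ℕ} (arr : Fin n → Fin n → PMF ℕ) : Measure (QueueState n) :=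
  Measure.pi fun i => Measure.pi fun j => (arr i j).toMeasure

/-- The transition kernel of the Markov chain of queue lengths: in state `q` a schedule is drawn
from `rule q`, the arrivals are drawn independently of it from `arrivalLaw arr`, and the chain
moves to `[q + a - s]⁺`. -/
noncomputable def queueKernel {n : ℕ} (arr : Fin n → Fin n → PMF ℕ)
    (rule : QueueState n → PMF (Equiv.Perm (Fin n))) : Kernel (QueueState n) (QueueState n) :=
  Kernel.ofFunOfCountable fun q =>
    ∑ s : Equiv.Perm (Fin n), rule q s • (arrivalLaw arr).map (fun a => nextQueue q a s)

/-- The weights `ζ`. Ports are numbered from `0`, so port `i` is saturated when `i < n₁`. -/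
noncomputable def zetaWeight (n n₁ n₂ : ℕ) (i j : Fin n) : ℝ :=
  if (i : ℕ) < n₁ then
    if (j : ℕ) < n₂ then 2 - (2 * (n : ℝ) - n₁ - n₂) / ((n : ℝ) ^ 2 - n₁ * n₂)
    else 1 + (n₂ : ℝ) / ((n : ℝ) ^ 2 - n₁ * n₂)
  else
    if (j : ℕ) < n₂ then 1 + (n₁ : ℝ) / ((n : ℝ) ^ 2 - n₁ * n₂)
    else 0

/-!
Let `T` be the orthogonal projection onto the span of the saturated rows and columns, and measure
the queue lengths against the cone these rows and columns generate. A mean arrival matrix that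
saturates exactly these ports leaves room, inside the capacity region, in every direction of the
polar cone, so MaxWeight pushes the projection of `q` on the polar cone back at a rate `δ` that does
not depend on `ε`. A drift argument for the fourth power of the norm of that projection then bounds
its third moment uniformly in `ε` (state space collapse), and this controls `q - T q`.

In steady state the drift of `‖T q‖ ^ 2` is zero, which writes `2 ε E ⟪T q, ν⟫` as the expectation
of `‖T (a - λ)‖ ^ 2` plus `O(ε ^ 2)` plus terms in the unused service `u`. Since `q⁺` and `u` have
disjoint supports, `⟪T q⁺, u⟫` only involves `q⁺ - T q⁺`; as the expected unused service of the
saturated ports is `O(ε)` and `q - T q` is bounded in mean square, Young's inequality with weight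
`√ε` makes these terms `O(√ε)`. Finally `n ⟪T q, ν⟫ = ⟪T q, 1⟫` is the total queue length up to
`O(1)`, the arrivals are uncorrelated, so `E ‖T (a - λ)‖ ^ 2` is the sum of the variances weighted
by the diagonal entries of `T`, and `n` times these entries are the `ζ i j`.
-/

lemma inner_starProjection_of_mem {E : Type*} [NormedAddCommGroup E] [InnerProductSpace ℝ E]
    (W : Submodule ℝ E) [W.HasOrthogonalProjection] (x : E) {v : E} (hv : v ∈ W) :
    inner ℝ (W.starProjection x) v = inner ℝ x v := by
  rw [W.inner_starProjection_left_eq_right, Submodule.starProjection_eq_self_iff.2 hv]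

section ConeProjection

variable {E : Type*} [NormedAddCommGroup E] [InnerProductSpace ℝ E] [CompleteSpace E]
  (C : ProperCone ℝ E)

lemma exists_mem_cone_inner_sub_nonpos (x : E) :
    ∃ p ∈ C, (∀ y ∈ C, inner ℝ (x - p) y ≤ 0) ∧ inner ℝ (x - p) p = 0 := by
  have hconvex : Convex ℝ (C : Set E) := C.toPointedCone.convex
  obtain ⟨p, hp, hmin⟩ := exists_norm_eq_iInf_of_complete_convex (K := (C : Set E))
    ⟨0, C.zero_mem⟩ C.isClosed.isComplete hconvex x
  rw [norm_eq_iInf_iff_real_inner_le_zero hconvex hp] at hmin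
  refine ⟨p, hp, fun y hy => by simpa using hmin (y + p) (C.add_mem hy hp), le_antisymm ?_ ?_⟩
  · simpa using hmin (p + p) (C.add_mem hp hp)
  · simpa using hmin 0 C.zero_mem

/-- The metric projection onto a closed convex cone `C`. In the proof `C` is the polar of the cone
`𝒦` of state space collapse, so `coneProj C x` is the component of `x` perpendicular to `𝒦`. -/
noncomputable def coneProj (x : E) : E := (exists_mem_cone_inner_sub_nonpos C x).choose

lemma coneProj_mem (x : E) : coneProj C x ∈ C :=
  (exists_mem_cone_inner_sub_nonpos C x).choose_spec.1

variable {C} in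
lemma inner_sub_coneProj_nonpos (x : E) {y : E} (hy : y ∈ C) :
    inner ℝ (x - coneProj C x) y ≤ 0 :=
  (exists_mem_cone_inner_sub_nonpos C x).choose_spec.2.1 y hy

lemma inner_sub_coneProj_self (x : E) : inner ℝ (x - coneProj C x) (coneProj C x) = 0 :=
  (exists_mem_cone_inner_sub_nonpos C x).choose_spec.2.2

lemma inner_coneProj_self (x : E) : inner ℝ x (coneProj C x) = ‖coneProj C x‖ ^ 2 := by
  have h := inner_sub_coneProj_self C x
  rwa [inner_sub_left, real_inner_self_eq_norm_sq, sub_eq_zero] at h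

lemma norm_coneProj_add_le (x z : E) : ‖coneProj C (x + z)‖ ≤ ‖coneProj C x + z‖ := by
  have hpolar : inner ℝ (x - coneProj C x) (coneProj C (x + z)) ≤ 0 :=
    inner_sub_coneProj_nonpos x (coneProj_mem C _)
  have hsq : ‖coneProj C (x + z)‖ ^ 2 ≤ ‖coneProj C x + z‖ * ‖coneProj C (x + z)‖ :=
    calc ‖coneProj C (x + z)‖ ^ 2 = inner ℝ (x - coneProj C x) (coneProj C (x + z))
          + inner ℝ (coneProj C x + z) (coneProj C (x + z)) := by
          rw [← inner_coneProj_self, ← inner_add_left]; congr 1; abel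
      _ ≤ ‖coneProj C x + z‖ * ‖coneProj C (x + z)‖ := by
          linarith [real_inner_le_norm (coneProj C x + z) (coneProj C (x + z))]
  rcases (norm_nonneg (coneProj C (x + z))).eq_or_lt with h | h
  · rw [← h]; positivity
  · nlinarith

@[simp] lemma coneProj_top (x : E) : coneProj (⊤ : ProperCone ℝ E) x = x := by
  have h := inner_sub_coneProj_nonpos x (ClosedSubmodule.mem_top (x := x - coneProj ⊤ x))
  rw [real_inner_self_eq_norm_sq] at h
  exact (sub_eq_zero.1 (norm_eq_zero.1 (pow_eq_zero_iff two_ne_zero |>.1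
    (le_antisymm h (sq_nonneg _))))).symm

variable {C} {W : Submodule ℝ E} (hW : ∀ y ∈ Wᗮ, y ∈ C)

include hW

lemma inner_sub_coneProj_eq_zero (x : E) {y : E} (hy : y ∈ Wᗮ) :
    inner ℝ (x - coneProj C x) y = 0 := by
  have hneg := inner_sub_coneProj_nonpos x (hW (-y) (Wᗮ.neg_mem hy))
  rw [inner_neg_right] at hneg
  linarith [inner_sub_coneProj_nonpos x (hW y hy)]

lemma norm_sub_starProjection_le [W.HasOrthogonalProjection] (x : E) :
    ‖x - W.starProjection x‖ ≤ ‖coneProj C x‖ := by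
  have hmem : x - coneProj C x ∈ W := by
    rw [← W.orthogonal_orthogonal, Submodule.mem_orthogonal']
    exact fun y hy => inner_sub_coneProj_eq_zero hW x hy
  rw [Submodule.starProjection_minimal]
  have hbdd : BddBelow (Set.range fun y : W => ‖x - y‖) :=
    ⟨0, Set.forall_mem_range.2 fun _ => norm_nonneg _⟩
  simpa using ciInf_le hbdd ⟨_, hmem⟩

end ConeProjection

/-- Real `n × n` matrices with the Frobenius inner product. -/
abbrev MatrixSpace (n : ℕ) := EuclideanSpace ℝ (Fin n × Fin n)

/-- A real matrix as a vector of `MatrixSpace`. -/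
noncomputable def toVec {n : ℕ} (x : Fin n → Fin n → ℝ) : MatrixSpace n :=
  WithLp.toLp 2 fun e => x e.1 e.2

/-- A matrix of natural numbers as a vector of `MatrixSpace`. -/
noncomputable def natVec {n : ℕ} (q : QueueState n) : MatrixSpace n :=
  toVec fun i j => (q i j : ℝ)

section Ports

variable {n : ℕ}

@[simp] lemma toVec_apply (x : Fin n → Fin n → ℝ) (e : Fin n × Fin n) :
    toVec x e = x e.1 e.2 := rfl

@[simp] lemma natVec_apply (q : QueueState n) (e : Fin n × Fin n) :
    natVec q e = (q e.1 e.2 : ℝ) := rfl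

lemma inner_eq_sum (x y : MatrixSpace n) : inner ℝ x y = ∑ i, ∑ j, x (i, j) * y (i, j) := by
  simp [PiLp.inner_apply, Fintype.sum_prod_type, mul_comm]

/-- The indicator matrix of row `i`, so that `⟪rowVec i, x⟫` is the `i`-th row sum of `x`. -/
noncomputable def rowVec (i : Fin n) : MatrixSpace n := toVec fun k _ => if k = i then 1 else 0

/-- The indicator matrix of column `j`, so that `⟪colVec j, x⟫` is the `j`-th column sum of `x`. -/
noncomputable def colVec (j : Fin n) : MatrixSpace n := toVec fun _ l => if l = j then 1 else 0

lemma inner_rowVec (i : Fin n) (x : MatrixSpace n) : inner ℝ (rowVec i) x = ∑ j, x (i, j) := by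
  simp [inner_eq_sum, rowVec]

lemma inner_colVec (j : Fin n) (x : MatrixSpace n) : inner ℝ (colVec j) x = ∑ i, x (i, j) := by
  simp [inner_eq_sum, colVec]

variable (R C : Finset (Fin n))

/-- The span of the indicators of the rows in `R` and the columns in `C`. -/
def portSpace : Submodule ℝ (MatrixSpace n) := Submodule.span ℝ (rowVec '' R ∪ colVec '' C)

/-- The matrices whose row sums over `R` and column sums over `C` are nonpositive: the polar of the
cone generated by the indicators of these rows and columns. -/
noncomputable def polarCone : ProperCone ℝ (MatrixSpace n) :=
  ProperCone.innerDual (-(rowVec '' R ∪ colVec '' C))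

variable {R C}

lemma mem_orthogonal_portSpace {y : MatrixSpace n} : y ∈ (portSpace R C)ᗮ ↔
    (∀ i ∈ R, ∑ j, y (i, j) = 0) ∧ ∀ j ∈ C, ∑ i, y (i, j) = 0 := by
  have hspan : y ∈ (portSpace R C)ᗮ ↔ ∀ x ∈ rowVec '' R ∪ colVec '' C, inner ℝ x y = 0 := by
    rw [← Submodule.span_singleton_le_iff_mem, Submodule.le_orthogonal_iff_le_orthogonal, portSpace,
      Submodule.span_le]
    simp [Set.subset_def, Submodule.mem_orthogonal_singleton_iff_inner_left]
  simp [hspan, or_imp, forall_and, inner_rowVec, inner_colVec]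

lemma mem_polarCone {y : MatrixSpace n} : y ∈ polarCone R C ↔
    (∀ i ∈ R, ∑ j, y (i, j) ≤ 0) ∧ ∀ j ∈ C, ∑ i, y (i, j) ≤ 0 := by
  have hneg (x : MatrixSpace n) : 0 ≤ inner ℝ x y ↔ inner ℝ (-x) y ≤ 0 := by simp
  simp only [polarCone, ProperCone.mem_innerDual, hneg, Set.mem_neg]
  rw [(Equiv.neg (MatrixSpace n)).forall_congr_left]
  simp [or_imp, forall_and, inner_rowVec, inner_colVec]

lemma orthogonal_portSpace_subset_polarCone {y : MatrixSpace n} (hy : y ∈ (portSpace R C)ᗮ) :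
    y ∈ polarCone R C := by
  rw [mem_orthogonal_portSpace] at hy
  exact mem_polarCone.2 ⟨fun i hi => (hy.1 i hi).le, fun j hj => (hy.2 j hj).le⟩

lemma polarCone_empty : polarCone (∅ : Finset (Fin n)) ∅ = ⊤ := by
  simp [polarCone]

lemma portSpace_apply_eq_zero {y : MatrixSpace n} (hy : y ∈ portSpace R C) {i j : Fin n}
    (hi : i ∉ R) (hj : j ∉ C) : y (i, j) = 0 := by
  have hrow (k) (hk : k ∈ R) : k ≠ i := fun h => hi (h ▸ hk)
  have hcol (l) (hl : l ∈ C) : l ≠ j := fun h => hj (h ▸ hl)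
  have hmem : EuclideanSpace.single (i, j) (1 : ℝ) ∈ (portSpace R C)ᗮ :=
    mem_orthogonal_portSpace.2 ⟨fun k hk => by simp [hrow k hk], fun l hl => by simp [hcol l hl]⟩
  simpa [EuclideanSpace.inner_single_left] using (Submodule.mem_orthogonal' _ _).1 hmem y hy

lemma toVec_add_mem_portSpace {w v : Fin n → ℝ} (hw : ∀ i ∉ R, w i = 0) (hv : ∀ j ∉ C, v j = 0) :
    toVec (fun i j => w i + v j) ∈ portSpace R C := by
  have hsum : toVec (fun i j => w i + v j) = ∑ i ∈ R, w i • rowVec i + ∑ j ∈ C, v j • colVec j := by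
    ext ⟨i, j⟩
    by_cases hi : i ∈ R <;> by_cases hj : j ∈ C <;> simp [rowVec, colVec, hi, hj, hw, hv]
  rw [hsum]
  refine add_mem (Submodule.sum_smul_mem _ _ fun i hi => ?_)
    (Submodule.sum_smul_mem _ _ fun j hj => ?_)
  · exact Submodule.subset_span (Or.inl ⟨i, hi, rfl⟩)
  · exact Submodule.subset_span (Or.inr ⟨j, hj, rfl⟩)

lemma sq_sub_card_mul_card_pos (hR : R.card < n) (hC : C.card < n) :
    (0 : ℝ) < (n : ℝ) ^ 2 - R.card * C.card := by
  have hprod : R.card * C.card < n * n := Nat.mul_lt_mul_of_lt_of_lt hR hC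
  rw [sub_pos, sq]
  exact_mod_cast hprod

/-- The row weights of the projection of the matrix unit `(i, j)` to `portSpace R C`. -/
noncomputable def portWeight (R C : Finset (Fin n)) (i j k : Fin n) : ℝ :=
  if k ∈ R then ((if k = i then 1 else 0) - (n * (if j ∈ C then 1 else 0)
    - C.card * (if i ∈ R then 1 else 0)) / ((n : ℝ) ^ 2 - R.card * C.card)) / n else 0

lemma portWeight_of_notMem {i j k : Fin n} (hk : k ∉ R) : portWeight R C i j k = 0 := if_neg hk

lemma sum_portWeight (hR : R.card < n) (hC : C.card < n) (i j : Fin n) :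
    ∑ k, portWeight R C i j k = (n * (if i ∈ R then 1 else 0)
      - R.card * (if j ∈ C then 1 else 0)) / ((n : ℝ) ^ 2 - R.card * C.card) := by
  have hn : (n : ℝ) ≠ 0 := by have := hR.pos; positivity
  have hD := (sq_sub_card_mul_card_pos hR hC).ne'
  simp only [portWeight, Finset.sum_ite_mem, Finset.univ_inter, ← Finset.sum_div,
    Finset.sum_sub_distrib, Finset.sum_ite_eq', Finset.sum_const, nsmul_eq_mul]
  field_simp
  ring

/-- The weights solve the normal equations: subtracting `w k + v l` from the matrix unit `(i, j)`
makes every row sum over `R` and every column sum over `C` vanish. -/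
lemma starProjection_portSpace_single (hR : R.card < n) (hC : C.card < n) (i j : Fin n) :
    (portSpace R C).starProjection (EuclideanSpace.single (i, j) 1) =
      toVec fun k l => portWeight R C i j k + portWeight C R j i l := by
  have hn : (n : ℝ) ≠ 0 := by have := hR.pos; positivity
  have hrow (k : Fin n) : ∑ l, EuclideanSpace.single (i, j) (1 : ℝ) (k, l) =
      if k = i then 1 else 0 := by by_cases h : k = i <;> simp [h]
  have hcol (l : Fin n) : ∑ k, EuclideanSpace.single (i, j) (1 : ℝ) (k, l) =
      if l = j then 1 else 0 := by by_cases h : l = j <;> simp [h]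
  refine Submodule.eq_starProjection_of_mem_orthogonal
    (toVec_add_mem_portSpace (fun _ => portWeight_of_notMem) fun _ => portWeight_of_notMem)
    (mem_orthogonal_portSpace.2 ⟨fun k hk => ?_, fun l hl => ?_⟩)
  · simp only [PiLp.sub_apply, toVec_apply, Finset.sum_sub_distrib, Finset.sum_add_distrib, hrow,
      sum_portWeight hC hR, Finset.sum_const, Finset.card_univ, Fintype.card_fin, nsmul_eq_mul,
      mul_comm (C.card : ℝ) R.card]
    rw [portWeight, if_pos hk, mul_div_cancel₀ _ hn]
    ring
  · simp only [PiLp.sub_apply, toVec_apply, Finset.sum_sub_distrib, Finset.sum_add_distrib, hcol,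
      sum_portWeight hR hC, Finset.sum_const, Finset.card_univ, Fintype.card_fin, nsmul_eq_mul]
    rw [portWeight, if_pos hl, mul_comm (C.card : ℝ) R.card, mul_div_cancel₀ _ hn]
    ring

/-- The input or output ports with index less than `m`. -/
def firstPorts (n m : ℕ) : Finset (Fin n) := Finset.univ.filter fun i => (i : ℕ) < m

lemma mem_firstPorts {m : ℕ} {i : Fin n} : i ∈ firstPorts n m ↔ (i : ℕ) < m := by
  simp [firstPorts]

lemma card_firstPorts {m : ℕ} (hm : m ≤ n) : (firstPorts n m).card = m := by
  simp [firstPorts, Fin.card_filter_val_lt, hm]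

lemma mul_starProjection_single_eq_zetaWeight {n₁ n₂ : ℕ} (hn₁ : n₁ < n) (hn₂ : n₂ < n)
    (i j : Fin n) :
    n * (portSpace (firstPorts n n₁) (firstPorts n n₂)).starProjection
      (EuclideanSpace.single (i, j) 1) (i, j) = zetaWeight n n₁ n₂ i j := by
  have hn : (n : ℝ) ≠ 0 := by have := hn₁.pos; positivity
  have hR : (firstPorts n n₁).card < n := by rwa [card_firstPorts hn₁.le]
  have hC : (firstPorts n n₂).card < n := by rwa [card_firstPorts hn₂.le]
  have hD : (n : ℝ) ^ 2 - n₁ * n₂ ≠ 0 := by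
    simpa only [card_firstPorts hn₁.le, card_firstPorts hn₂.le] using
      (sq_sub_card_mul_card_pos hR hC).ne'
  rw [starProjection_portSpace_single hR hC, toVec_apply]
  simp only [portWeight, mem_firstPorts, card_firstPorts hn₁.le, card_firstPorts hn₂.le, if_true,
    mul_comm (n₂ : ℝ) n₁, zetaWeight]
  split_ifs <;> field_simp <;> ring

end Ports

lemma exists_mem_doublyStochastic_ge {ι 𝕜 : Type*} [Fintype ι] [DecidableEq ι] [Field 𝕜]
    [LinearOrder 𝕜] [IsStrictOrderedRing 𝕜] {A : Matrix ι ι 𝕜} (hA : ∀ i j, 0 ≤ A i j)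
    (hrow : ∀ i, ∑ j, A i j ≤ 1) (hcol : ∀ j, ∑ i, A i j ≤ 1) :
    ∃ M ∈ doublyStochastic 𝕜 ι, ∀ i j, A i j ≤ M i j := by
  set r : ι → 𝕜 := fun i => 1 - ∑ j, A i j with hr
  set c : ι → 𝕜 := fun j => 1 - ∑ i, A i j with hc
  have hr0 (i : ι) : 0 ≤ r i := sub_nonneg.2 (hrow i)
  have hc0 (j : ι) : 0 ≤ c j := sub_nonneg.2 (hcol j)
  have hcr : ∑ j, c j = ∑ i, r i := by simp [hr, hc, Finset.sum_comm (γ := ι)]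
  have hrt (i : ι) : r i * (∑ k, r k) / ∑ k, r k = r i :=
    mul_div_cancel_of_imp fun h =>
      (Finset.sum_eq_zero_iff_of_nonneg fun k _ => hr0 k).1 h i (Finset.mem_univ i)
  have hct (j : ι) : (∑ k, r k) * c j / ∑ k, r k = c j :=
    mul_div_cancel_left_of_imp fun h =>
      (Finset.sum_eq_zero_iff_of_nonneg fun k _ => hc0 k).1 (hcr.trans h) j (Finset.mem_univ j)
  have hfill (i j : ι) : 0 ≤ r i * c j / ∑ k, r k :=
    div_nonneg (mul_nonneg (hr0 i) (hc0 j)) (Finset.sum_nonneg fun k _ => hr0 k)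
  refine ⟨Matrix.of fun i j => A i j + r i * c j / ∑ k, r k, ?_,
    fun i j => le_add_of_nonneg_right (hfill i j)⟩
  rw [mem_doublyStochastic_iff_sum]
  refine ⟨fun i j => add_nonneg (hA i j) (hfill i j), fun i => ?_, fun j => ?_⟩
  · simp only [Matrix.of_apply, Finset.sum_add_distrib, ← Finset.sum_div, ← Finset.mul_sum, hcr,
      hrt]
    exact add_sub_cancel _ _
  · simp only [Matrix.of_apply, Finset.sum_add_distrib, ← Finset.sum_div, ← Finset.sum_mul, hct]
    exact add_sub_cancel _ _

lemma exists_add_smul_sub_mem_of_mem_intrinsicInterior {V : Type*} [NormedAddCommGroup V]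
    [NormedSpace ℝ V] {s : Set V} {x y : V} (hx : x ∈ intrinsicInterior ℝ s) (hy : y ∈ s) :
    ∃ c > (0 : ℝ), x + c • (x - y) ∈ s := by
  obtain ⟨x', hx', rfl⟩ := mem_intrinsicInterior.1 hx
  have hline (c : ℝ) : (x' : V) + c • (x' - y) ∈ affineSpan ℝ s := by
    convert AffineMap.lineMap_mem (-c) x'.2 (subset_affineSpan ℝ s hy) using 1
    rw [AffineMap.lineMap_apply, vsub_eq_sub, vadd_eq_add]
    module
  have hcont : Continuous fun c : ℝ => (⟨_, hline c⟩ : affineSpan ℝ s) := by fun_prop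
  have hnear : ∀ᶠ c in 𝓝 (0 : ℝ), (x' : V) + c • (x' - y) ∈ s :=
    hcont.continuousAt.eventually_mem (s := ((↑) : affineSpan ℝ s → V) ⁻¹' s)
      (by simpa using mem_interior_iff_mem_nhds.1 hx')
  obtain ⟨c, hcs, hc⟩ :=
    ((hnear.filter_mono nhdsWithin_le_nhds).and (self_mem_nhdsWithin (s := Set.Ioi 0))).exists
  exact ⟨c, hc, hcs⟩

section MaxWeight

variable {n : ℕ}

lemma scheduleMatrix_le_one (s : Equiv.Perm (Fin n)) (i j : Fin n) : scheduleMatrix s i j ≤ 1 := by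
  unfold scheduleMatrix; split_ifs <;> simp

lemma sum_scheduleMatrix_row (s : Equiv.Perm (Fin n)) (i : Fin n) :
    ∑ j, (scheduleMatrix s i j : ℝ) = 1 := by
  simp [scheduleMatrix]

lemma sum_scheduleMatrix_col (s : Equiv.Perm (Fin n)) (j : Fin n) :
    ∑ i, (scheduleMatrix s i j : ℝ) = 1 := by
  simp [scheduleMatrix, ← Equiv.eq_symm_apply]

lemma scheduleWeight_eq_inner (q : QueueState n) (s : Equiv.Perm (Fin n)) :
    (scheduleWeight q s : ℝ) = inner ℝ (natVec q) (natVec (scheduleMatrix s)) := by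
  simp [scheduleWeight, inner_eq_sum]

lemma IsMaxWeight.inner_le {q : QueueState n} {s : Equiv.Perm (Fin n)} (hs : IsMaxWeight q s)
    {y : Fin n → Fin n → ℝ} (hy : y ∈ capacityRegion n) :
    inner ℝ (natVec q) (toVec y) ≤ inner ℝ (natVec q) (natVec (scheduleMatrix s)) := by
  obtain ⟨M, hM, hyM⟩ := exists_mem_doublyStochastic_ge hy.1 hy.2.1 hy.2.2
  obtain ⟨w, hw0, hw1, rfl⟩ := exists_eq_sum_perm_of_mem_doublyStochastic hM
  have hyw (e : Fin n × Fin n) : toVec y e ≤ (∑ τ, w τ • natVec (scheduleMatrix τ)) e := by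
    simpa [Matrix.sum_apply, Equiv.Perm.permMatrix, PEquiv.toMatrix_apply, scheduleMatrix] using
      hyM e.1 e.2
  calc inner ℝ (natVec q) (toVec y)
      ≤ inner ℝ (natVec q) (∑ τ, w τ • natVec (scheduleMatrix τ)) := by
        simp only [inner_eq_sum, natVec_apply]
        gcongr with i _ j _
        exact hyw (i, j)
    _ = ∑ τ, w τ * scheduleWeight q τ := by
        simp only [inner_sum, inner_smul_right, scheduleWeight_eq_inner]
    _ ≤ ∑ τ, w τ * scheduleWeight q s := by
        gcongr with τ
        · exact hw0 τ
        · exact hs τ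
    _ = inner ℝ (natVec q) (natVec (scheduleMatrix s)) := by
        rw [← Finset.sum_mul, hw1, one_mul, scheduleWeight_eq_inner]

/-- Strictly positive rates that saturate exactly the rows in `R` and the columns in `C`. For the
first ports this is what remains of lying in the relative interior of the face. -/
structure SaturatesExactly (R C : Finset (Fin n)) (ν : Fin n → Fin n → ℝ) : Prop where
  pos : ∀ i j, 0 < ν i j
  row_eq : ∀ i ∈ R, ∑ j, ν i j = 1
  col_eq : ∀ j ∈ C, ∑ i, ν i j = 1
  row_lt : ∀ i ∉ R, ∑ j, ν i j < 1
  col_lt : ∀ j ∉ C, ∑ i, ν i j < 1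

lemma update_zero_mem_saturatedFace {n₁ n₂ : ℕ} {ν : Fin n → Fin n → ℝ}
    (hν : ν ∈ saturatedFace n n₁ n₂) {k l : Fin n} (hk : n₁ ≤ k) (hl : n₂ ≤ l) :
    Function.update ν k (Function.update (ν k) l 0) ∈ saturatedFace n n₁ n₂ := by
  obtain ⟨⟨h0, hr, hc⟩, hr1, hc1⟩ := hν
  have hentry (i j : Fin n) : Function.update ν k (Function.update (ν k) l 0) i j =
      if i = k ∧ j = l then 0 else ν i j := by
    by_cases hi : i = k <;> by_cases hj : j = l <;> simp [hi, hj]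
  have hle (i j : Fin n) : (if i = k ∧ j = l then 0 else ν i j) ≤ ν i j := by
    split_ifs
    exacts [h0 i j, le_rfl]
  simp only [saturatedFace, capacityRegion, Set.mem_ofPred_eq, hentry]
  refine ⟨⟨fun i j => ?_, fun i => (Finset.sum_le_sum fun j _ => hle i j).trans (hr i),
    fun j => (Finset.sum_le_sum fun i _ => hle i j).trans (hc j)⟩, fun i hi => ?_, fun j hj => ?_⟩
  · split_ifs
    exacts [le_rfl, h0 i j]
  · have hik : i ≠ k := by rintro rfl; omega
    simpa [hik] using hr1 i hi
  · have hjl : j ≠ l := by rintro rfl; omega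
    simpa [hjl] using hc1 j hj

lemma sum_lt_one_of_mem_intrinsicInterior {n₁ n₂ : ℕ} {ν : Fin n → Fin n → ℝ}
    (hν : ν ∈ intrinsicInterior ℝ (saturatedFace n n₁ n₂)) {k l : Fin n} (hpos : 0 < ν k l)
    (hk : n₁ ≤ k) (hl : n₂ ≤ l) : ∑ j, ν k j < 1 ∧ ∑ i, ν i l < 1 := by
  have hface := intrinsicInterior_subset hν
  obtain ⟨c, hc, ⟨⟨-, hr, hcol⟩, -⟩⟩ := exists_add_smul_sub_mem_of_mem_intrinsicInterior hν
    (update_zero_mem_saturatedFace hface hk hl)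
  have hrow := hr k
  have hcol := hcol l
  have hck := mul_pos hc hpos
  have hentry (i j : Fin n) : Function.update ν k (Function.update (ν k) l 0) i j =
      ν i j - if i = k ∧ j = l then ν k l else 0 := by
    by_cases hi : i = k <;> by_cases hj : j = l <;> simp [hi, hj]
  simp only [Pi.add_apply, Pi.smul_apply, Pi.sub_apply, smul_eq_mul, hentry, sub_sub_cancel,
    true_and, and_true, Finset.sum_add_distrib, ← Finset.mul_sum, Finset.sum_ite_eq',
    Finset.mem_univ, if_true] at hrow hcol
  constructor <;> linarith

lemma saturatesExactly_of_mem_intrinsicInterior {n₁ n₂ : ℕ} (hn₁ : n₁ < n) (hn₂ : n₂ < n)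
    {ν : Fin n → Fin n → ℝ} (hν : ν ∈ intrinsicInterior ℝ (saturatedFace n n₁ n₂))
    (hpos : ∀ i j, 0 < ν i j) : SaturatesExactly (firstPorts n n₁) (firstPorts n n₂) ν := by
  obtain ⟨-, hrow, hcol⟩ := intrinsicInterior_subset hν
  refine ⟨hpos, fun i hi => hrow i (mem_firstPorts.1 hi), fun j hj => hcol j (mem_firstPorts.1 hj),
    fun i hi => ?_, fun j hj => ?_⟩
  · exact (sum_lt_one_of_mem_intrinsicInterior hν (hpos i ⟨n₂, hn₂⟩)
      (by simpa [mem_firstPorts] using hi) le_rfl).1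
  · exact (sum_lt_one_of_mem_intrinsicInterior hν (hpos ⟨n₁, hn₁⟩ j) le_rfl
      (by simpa [mem_firstPorts] using hj)).2

namespace SaturatesExactly

variable {R C : Finset (Fin n)} {ν : Fin n → Fin n → ℝ} (hν : SaturatesExactly R C ν)

include hν

lemma sub_mem_orthogonal (s : Equiv.Perm (Fin n)) :
    toVec ν - natVec (scheduleMatrix s) ∈ (portSpace R C)ᗮ := by
  rw [mem_orthogonal_portSpace]
  refine ⟨fun i hi => ?_, fun j hj => ?_⟩
  · simp [Finset.sum_sub_distrib, hν.row_eq i hi, sum_scheduleMatrix_row]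
  · simp [Finset.sum_sub_distrib, hν.col_eq j hj, sum_scheduleMatrix_col]

lemma exists_perturbation_mem_capacityRegion : ∃ δ > 0, ∀ y ∈ polarCone R C, ‖y‖ ≤ 1 →
    (fun i j => ν i j + δ * y (i, j)) ∈ capacityRegion n := by
  have hsmall (k : ℝ) {c : ℝ} (hc : 0 < c) : ∀ᶠ δ in 𝓝[>] (0 : ℝ), δ * k < c :=
    (((continuous_mul_const k).tendsto' 0 0 (zero_mul k)).eventually_lt_const hc).filter_mono
      nhdsWithin_le_nhds
  have hentry : ∀ᶠ δ in 𝓝[>] (0 : ℝ), ∀ i j, δ * 1 < ν i j :=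
    eventually_all.2 fun i => eventually_all.2 fun j => hsmall 1 (hν.pos i j)
  have hrow : ∀ᶠ δ in 𝓝[>] (0 : ℝ), ∀ i ∉ R, δ * n < 1 - ∑ j, ν i j :=
    eventually_all.2 fun i => eventually_imp_distrib_left.2 fun hi =>
      hsmall n (sub_pos.2 (hν.row_lt i hi))
  have hcol : ∀ᶠ δ in 𝓝[>] (0 : ℝ), ∀ j ∉ C, δ * n < 1 - ∑ i, ν i j :=
    eventually_all.2 fun j => eventually_imp_distrib_left.2 fun hj =>
      hsmall n (sub_pos.2 (hν.col_lt j hj))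
  obtain ⟨δ, ⟨⟨⟨hentry, hrow⟩, hcol⟩, hδ⟩⟩ :=
    (((hentry.and hrow).and hcol).and (self_mem_nhdsWithin (s := Set.Ioi 0))).exists
  have hδ : 0 < δ := hδ
  refine ⟨δ, hδ, fun y hy hy1 => ?_⟩
  obtain ⟨hyR, hyC⟩ := mem_polarCone.1 hy
  have habs (e : Fin n × Fin n) : -1 ≤ y e ∧ y e ≤ 1 :=
    abs_le.1 ((PiLp.norm_apply_le y e).trans hy1)
  have hsum {f : Fin n → ℝ} (hf : ∀ k, f k ≤ 1) : ∑ k, f k ≤ n := by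
    simpa using Finset.sum_le_sum fun k (_ : k ∈ Finset.univ) => hf k
  refine ⟨fun i j => ?_, fun i => ?_, fun j => ?_⟩
  · nlinarith [hentry i j, habs (i, j)]
  · rw [Finset.sum_add_distrib, ← Finset.mul_sum]
    by_cases hi : i ∈ R
    · nlinarith [hν.row_eq i hi, hyR i hi]
    · nlinarith [hrow i hi, hsum fun j => (habs (i, j)).2]
  · rw [Finset.sum_add_distrib, ← Finset.mul_sum]
    by_cases hj : j ∈ C
    · nlinarith [hν.col_eq j hj, hyC j hj]
    · nlinarith [hcol j hj, hsum fun i => (habs (i, j)).2]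

lemma exists_inner_coneProj_sub_le : ∃ δ > 0, ∀ (q : QueueState n) (s : Equiv.Perm (Fin n)),
    IsMaxWeight q s →
    inner ℝ (coneProj (polarCone R C) (natVec q)) (toVec ν - natVec (scheduleMatrix s)) ≤
      -δ * ‖coneProj (polarCone R C) (natVec q)‖ := by
  obtain ⟨δ, hδ, hcap⟩ := hν.exists_perturbation_mem_capacityRegion
  refine ⟨δ, hδ, fun q s hs => ?_⟩
  set p := coneProj (polarCone R C) (natVec q) with hp
  have hunit : ‖‖p‖⁻¹ • p‖ ≤ 1 := by
    rw [norm_smul, norm_inv, norm_norm]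
    exact inv_mul_le_one
  have hmem : ‖p‖⁻¹ • p ∈ polarCone R C :=
    (polarCone R C).smul_mem (coneProj_mem _ _) (inv_nonneg.2 (norm_nonneg p))
  have hvec : toVec (fun i j => ν i j + δ * (‖p‖⁻¹ • p) (i, j)) = toVec ν + (δ * ‖p‖⁻¹) • p := by
    ext e
    simp [mul_assoc]
  have hopt : inner ℝ (natVec q) (toVec ν) + δ * ‖p‖ ≤
      inner ℝ (natVec q) (natVec (scheduleMatrix s)) := by
    have h := hs.inner_le (hcap _ hmem hunit)
    rwa [hvec, inner_add_right, inner_smul_right, inner_coneProj_self, ← hp, mul_assoc, sq,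
      ← mul_assoc ‖p‖⁻¹, inv_mul_mul_self] at h
  have horth : inner ℝ (natVec q - p) (toVec ν - natVec (scheduleMatrix s)) = 0 :=
    inner_sub_coneProj_eq_zero (fun _ => orthogonal_portSpace_subset_polarCone) _
      (hν.sub_mem_orthogonal s)
  rw [inner_sub_left, inner_sub_right (natVec q)] at horth
  linarith

end SaturatesExactly

end MaxWeight

section UnusedService

variable {n : ℕ} (q a : QueueState n) (s : Equiv.Perm (Fin n))

/-- The service that is wasted because the queues are too short. -/
def unusedService : QueueState n :=
  fun i j => scheduleMatrix s i j - (q i j + a i j)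

lemma unusedService_le_one (i j : Fin n) : unusedService q a s i j ≤ 1 :=
  (Nat.sub_le _ _).trans (scheduleMatrix_le_one s i j)

lemma natVec_nextQueue : natVec (nextQueue q a s) =
    natVec q + natVec a - natVec (scheduleMatrix s) + natVec (unusedService q a s) := by
  ext e
  have h : nextQueue q a s e.1 e.2 + scheduleMatrix s e.1 e.2 =
      q e.1 e.2 + a e.1 e.2 + unusedService q a s e.1 e.2 := by
    unfold nextQueue unusedService; omega
  simp only [PiLp.add_apply, PiLp.sub_apply, natVec_apply]
  have h' : (nextQueue q a s e.1 e.2 : ℝ) + scheduleMatrix s e.1 e.2 =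
      q e.1 e.2 + a e.1 e.2 + unusedService q a s e.1 e.2 := by exact_mod_cast h
  linarith

lemma natVec_nextQueue_mul_unusedService (e : Fin n × Fin n) :
    natVec (nextQueue q a s) e * natVec (unusedService q a s) e = 0 := by
  rw [natVec_apply, natVec_apply, mul_eq_zero, Nat.cast_eq_zero, Nat.cast_eq_zero]
  unfold nextQueue unusedService
  omega

lemma inner_natVec_unusedService : inner ℝ (natVec q) (natVec (unusedService q a s)) = 0 := by
  rw [inner_eq_sum]
  refine Finset.sum_eq_zero fun i _ => Finset.sum_eq_zero fun j _ => ?_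
  have hs := scheduleMatrix_le_one s i j
  have hzero : q i j = 0 ∨ unusedService q a s i j = 0 := by unfold unusedService; omega
  rcases hzero with h | h <;> simp [h]

lemma norm_natVec_le {b : ℕ} (hq : ∀ i j, q i j ≤ b) : ‖natVec q‖ ≤ n * b := by
  rw [EuclideanSpace.norm_eq, Real.sqrt_le_left (by positivity)]
  calc ∑ e, ‖natVec q e‖ ^ 2 ≤ ∑ _e : Fin n × Fin n, (b : ℝ) ^ 2 := by
        gcongr with e
        rw [natVec_apply, Real.norm_natCast]
        exact_mod_cast hq e.1 e.2
    _ = (n * b) ^ 2 := by simp; ring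

lemma norm_queue_increment_le {b : ℕ} (ha : ∀ i j, a i j ≤ b) :
    ‖natVec a - natVec (scheduleMatrix s) + natVec (unusedService q a s)‖ ≤ n * (b + 2) := by
  have hs := norm_natVec_le (scheduleMatrix s) (scheduleMatrix_le_one s)
  have hu := norm_natVec_le (unusedService q a s) (unusedService_le_one q a s)
  calc _ ≤ ‖natVec a‖ + ‖natVec (scheduleMatrix s)‖ + ‖natVec (unusedService q a s)‖ :=
        (norm_add_le _ _).trans (by gcongr; exact norm_sub_le _ _)
    _ ≤ n * (b + 2) := by push_cast at hs hu; linarith [norm_natVec_le a ha]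

variable {R C : Finset (Fin n)}

lemma inner_coneProj_unusedService_nonpos :
    inner ℝ (coneProj (polarCone R C) (natVec q)) (natVec (unusedService q a s)) ≤ 0 := by
  have hmem : -natVec (unusedService q a s) ∈ polarCone R C := by
    rw [mem_polarCone]
    constructor <;> intros <;>
      simp only [PiLp.neg_apply, natVec_apply, Finset.sum_neg_distrib, neg_nonpos] <;> positivity
  have h := inner_sub_coneProj_nonpos (natVec q) hmem
  rw [inner_neg_right, inner_sub_left, inner_natVec_unusedService] at h
  linarith

variable {q a s}

lemma sq_norm_coneProj_nextQueue_le {ν : Fin n → Fin n → ℝ} {δ ε : ℝ} {b : ℕ}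
    (hdrift : inner ℝ (coneProj (polarCone R C) (natVec q)) (toVec ν - natVec (scheduleMatrix s)) ≤
      -δ * ‖coneProj (polarCone R C) (natVec q)‖)
    (hε : 0 ≤ ε) (hεδ : ε * ‖toVec ν‖ ≤ δ / 2) (ha : ∀ i j, a i j ≤ b) :
    ‖coneProj (polarCone R C) (natVec (nextQueue q a s))‖ ^ 2 ≤
      ‖coneProj (polarCone R C) (natVec q)‖ ^ 2 +
      (2 * inner ℝ (coneProj (polarCone R C) (natVec q)) (natVec a - (1 - ε) • toVec ν)
        - δ * ‖coneProj (polarCone R C) (natVec q)‖ + (n * (b + 2)) ^ 2) := by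
  set p := coneProj (polarCone R C) (natVec q)
  set z := natVec a - natVec (scheduleMatrix s) + natVec (unusedService q a s) with hz
  have hnext : natVec (nextQueue q a s) = natVec q + z := by
    rw [natVec_nextQueue, hz]; abel
  have hcontract : ‖coneProj (polarCone R C) (natVec (nextQueue q a s))‖ ^ 2 ≤ ‖p + z‖ ^ 2 := by
    rw [hnext]; gcongr; exact norm_coneProj_add_le _ _ _
  have hsplit : inner ℝ p z = inner ℝ p (natVec a - (1 - ε) • toVec ν) +
      inner ℝ p (toVec ν - natVec (scheduleMatrix s)) - ε * inner ℝ p (toVec ν) +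
      inner ℝ p (natVec (unusedService q a s)) := by
    rw [← inner_smul_right, ← inner_add_right, ← inner_sub_right, ← inner_add_right, hz]
    congr 1; module
  have hunused : inner ℝ p (natVec (unusedService q a s)) ≤ 0 :=
    inner_coneProj_unusedService_nonpos q a s
  have hslack : -(ε * inner ℝ p (toVec ν)) ≤ δ / 2 * ‖p‖ :=
    calc -(ε * inner ℝ p (toVec ν)) ≤ ε * (‖p‖ * ‖toVec ν‖) := by
          rw [← mul_neg]
          gcongr
          exact (neg_le_abs _).trans (abs_real_inner_le_norm _ _)
      _ = ε * ‖toVec ν‖ * ‖p‖ := by ring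
      _ ≤ δ / 2 * ‖p‖ := by gcongr
  have hstep : ‖z‖ ^ 2 ≤ (n * (b + 2)) ^ 2 := by gcongr; exact norm_queue_increment_le q a s ha
  rw [norm_add_sq_real] at hcontract
  linarith

end UnusedService

section Drift

variable {Ω : Type*} [MeasurableSpace Ω] {P : Measure Ω}

lemma integral_min_sub_min_eq_zero [IsFiniteMeasure P] {V V' : Ω → ℝ} (hV0 : ∀ᵐ ω ∂P, 0 ≤ V ω)
    (hid : IdentDistrib V' V P P) {k : ℝ} (hk : 0 ≤ k) :
    Integrable (fun ω => min (V' ω) k - min (V ω) k) P ∧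
      ∫ ω, min (V' ω) k - min (V ω) k ∂P = 0 := by
  have hid_min : IdentDistrib (fun ω => min (V' ω) k) (fun ω => min (V ω) k) P P :=
    hid.comp (u := fun x => min x k) (by fun_prop)
  have hint : Integrable (fun ω => min (V ω) k) P := by
    refine Integrable.of_bound hid_min.aemeasurable_snd.aestronglyMeasurable k ?_
    filter_upwards [hV0] with ω hω
    rw [Real.norm_of_nonneg (le_min hω hk)]
    exact min_le_right _ _
  have hint' : Integrable (fun ω => min (V' ω) k) P := hid_min.integrable_iff.2 hint
  exact ⟨hint'.sub hint, by rw [integral_sub hint' hint, hid_min.integral_eq, sub_self]⟩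

variable [IsProbabilityMeasure P]

/- A Foster–Lyapunov bound: as neither `V` nor `ξ` need be integrable, the drift inequality is
integrated for the truncations `min V k`. -/
theorem integrable_and_integral_le_of_drift {V V' ξ g : Ω → ℝ} {K : ℝ} (hV : Measurable V)
    (hV0 : ∀ᵐ ω ∂P, 0 ≤ V ω) (hid : IdentDistrib V' V P P) (hg : AEStronglyMeasurable g P)
    (hg0 : 0 ≤ᵐ[P] g) (hK : 0 ≤ K) (hξ : ∀ k : ℕ, IntegrableOn ξ {ω | V ω ≤ k} P)
    (hξ0 : ∀ k : ℕ, ∫ ω in {ω | V ω ≤ k}, ξ ω ∂P = 0)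
    (hdrift : ∀ᵐ ω ∂P, V' ω ≤ V ω + (ξ ω - g ω + K)) :
    Integrable g P ∧ ∫ ω, g ω ∂P ≤ K := by
  have hmeas (k : ℕ) : MeasurableSet {ω | V ω ≤ k} := measurableSet_le hV measurable_const
  have hV'0 : ∀ᵐ ω ∂P, 0 ≤ V' ω := hid.symm.ae_mem_snd measurableSet_Ici hV0
  have hgk (k : ℕ) : IntegrableOn g {ω | V ω ≤ k} P := by
    refine Integrable.mono' ((hξ k).add (integrable_const (K + k))) hg.restrict ?_
    filter_upwards [ae_restrict_of_ae hg0, ae_restrict_of_ae hdrift, ae_restrict_of_ae hV'0,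
      ae_restrict_mem (hmeas k)] with ω hgω hdω hV'ω hVk
    rw [Real.norm_of_nonneg hgω, Pi.add_apply]
    linarith
  have hle (k : ℕ) : ∫ ω in {ω | V ω ≤ k}, g ω ∂P ≤ K := by
    obtain ⟨hint, hzero⟩ := integral_min_sub_min_eq_zero hV0 hid (Nat.cast_nonneg (α := ℝ) k)
    have htrunc : ∫ ω, min (V' ω) k - min (V ω) k ∂P ≤
        ∫ ω in {ω | V ω ≤ k}, ξ ω - g ω + K ∂P := by
      rw [← integral_indicator (hmeas k)]
      refine integral_mono_ae hint
        ((integrable_indicator_iff (hmeas k)).2 (((hξ k).sub (hgk k)).add (integrable_const K))) ?_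
      filter_upwards [hdrift] with ω hω
      by_cases hVk : ω ∈ {ω | V ω ≤ k}
      · rw [Set.indicator_of_mem hVk, min_eq_left (Set.mem_ofPred.1 hVk)]
        linarith [min_le_left (V' ω) k]
      · rw [Set.indicator_of_notMem hVk, min_eq_right (not_le.1 (Set.mem_ofPred.not.1 hVk)).le]
        linarith [min_le_right (V' ω) k]
    rw [hzero, integral_add (f := fun ω => ξ ω - g ω) ((hξ k).sub (hgk k)) (integrable_const K),
      integral_sub (hξ k) (hgk k), hξ0, setIntegral_const, smul_eq_mul] at htrunc
    nlinarith [measureReal_le_one (μ := P) (s := {ω | V ω ≤ k})]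
  have hcover : AECover P atTop fun k : ℕ => {ω | V ω ≤ k} :=
    { ae_eventually_mem := ae_of_all _ fun ω =>
        tendsto_natCast_atTop_atTop.eventually_ge_atTop (V ω)
      measurableSet := hmeas }
  have hint : Integrable g P :=
    hcover.integrable_of_integral_bounded_of_nonneg_ae K hgk hg0 (.of_forall hle)
  exact ⟨hint, le_of_tendsto' (hcover.integral_tendsto_of_countably_generated hint) hle⟩

lemma pow_four_le_of_sq_le {d d' x δ L M : ℝ} (hd : 0 ≤ d) (hδ : 0 < δ)
    (hx : |x| ≤ M * d) (h : d' ^ 2 ≤ d ^ 2 + (2 * x - δ * d + L ^ 2)) :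
    d' ^ 4 ≤ d ^ 4 + (4 * d ^ 2 * x - δ * d ^ 3 +
      ((2 * L ^ 2 + 2 * (2 * M + δ) ^ 2) ^ 3 / δ ^ 2 + 2 * L ^ 4)) := by
  set w := 2 * x - δ * d + L ^ 2 with hw
  set b := 2 * L ^ 2 + 2 * (2 * M + δ) ^ 2 with hb
  have hb0 : 0 ≤ b := by positivity
  have hsq : d' ^ 4 ≤ (d ^ 2 + w) ^ 2 := by
    have := pow_le_pow_left₀ (sq_nonneg d') h 2
    linarith [this, (by ring : (d' ^ 2) ^ 2 = d' ^ 4)]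
  have hw_abs : (2 * x - δ * d) ^ 2 ≤ ((2 * M + δ) * d) ^ 2 := by
    rw [abs_le] at hx
    exact sq_le_sq' (by nlinarith) (by nlinarith)
  have hw_sq : w ^ 2 ≤ 2 * ((2 * M + δ) * d) ^ 2 + 2 * L ^ 4 := by
    nlinarith [sq_nonneg (2 * x - δ * d - L ^ 2)]
  have hyoung : b * d ^ 2 ≤ δ * d ^ 3 + b ^ 3 / δ ^ 2 := by
    rcases le_total b (δ * d) with hbd | hbd
    · have : 0 ≤ b ^ 3 / δ ^ 2 := by positivity
      nlinarith [mul_le_mul_of_nonneg_right hbd (sq_nonneg d)]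
    · have hdb : d ≤ b / δ := by rwa [le_div_iff₀ hδ, mul_comm]
      calc b * d ^ 2 ≤ b * (b / δ) ^ 2 := by gcongr
        _ = b ^ 3 / δ ^ 2 := by ring
        _ ≤ δ * d ^ 3 + b ^ 3 / δ ^ 2 := by linarith [show 0 ≤ δ * d ^ 3 by positivity]
  calc d' ^ 4 ≤ d ^ 4 + 2 * d ^ 2 * w + w ^ 2 := by linarith
    _ ≤ d ^ 4 + 4 * d ^ 2 * x - 2 * (δ * d ^ 3) + b * d ^ 2 + 2 * L ^ 4 := by
        rw [hb]; linear_combination hw_sq + 2 * d ^ 2 * hw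
    _ ≤ _ := by linarith

end Drift

section Moments

variable {Ω : Type*} [MeasurableSpace Ω] {P : Measure Ω}

lemma integrable_inner_and_integral_inner_eq_zero {E : Type*} [NormedAddCommGroup E]
    [InnerProductSpace ℝ E] [CompleteSpace E] [MeasurableSpace E] [BorelSpace E] {X Y : Ω → E}
    (hXY : IndepFun X Y P) (hX : Integrable X P) (hY : Integrable Y P) (hY0 : ∫ ω, Y ω ∂P = 0) :
    Integrable (fun ω => inner ℝ (X ω) (Y ω)) P ∧ ∫ ω, inner ℝ (X ω) (Y ω) ∂P = 0 := by
  refine ⟨hXY.integrable_bilin hX hY (innerSL ℝ), ?_⟩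
  exact (hXY.integral_bilin hX hY (innerSL ℝ)).trans (by rw [hY0, map_zero])

lemma integrable_pow_and_integral_pow_le [IsProbabilityMeasure P] {f : Ω → ℝ}
    (hf : AEStronglyMeasurable f P) (hf₀ : ∀ ω, 0 ≤ f ω) {k m : ℕ} (hkm : k ≤ m)
    (hint : Integrable (fun ω => f ω ^ m) P) :
    Integrable (fun ω => f ω ^ k) P ∧ ∫ ω, f ω ^ k ∂P ≤ 1 + ∫ ω, f ω ^ m ∂P := by
  have hle (ω) : f ω ^ k ≤ 1 + f ω ^ m := by
    rcases le_total (f ω) 1 with h | h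
    · linarith [pow_le_one₀ (n := k) (hf₀ ω) h, pow_nonneg (hf₀ ω) m]
    · linarith [pow_le_pow_right₀ h hkm]
  have hbound : Integrable (fun ω => 1 + f ω ^ m) P := (integrable_const 1).add hint
  have hk : Integrable (fun ω => f ω ^ k) P := hbound.mono' (hf.pow k) (.of_forall fun ω => by
    rw [Real.norm_of_nonneg (pow_nonneg (hf₀ ω) k)]
    exact hle ω)
  refine ⟨hk, (integral_mono hk hbound hle).trans_eq ?_⟩
  rw [integral_add (integrable_const 1) hint]
  simp

variable {ι : Type*} [Fintype ι] [DecidableEq ι] (W : Submodule ℝ (EuclideanSpace ℝ ι))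

lemma sq_norm_starProjection_eq_sum (z : EuclideanSpace ℝ ι) : ‖W.starProjection z‖ ^ 2 =
    ∑ e, ∑ f, W.starProjection (EuclideanSpace.single e 1) f * (z e * z f) := by
  have hcoord (e : ι) : W.starProjection z e =
      ∑ f, W.starProjection (EuclideanSpace.single e 1) f * z f := by
    have hself : W.starProjection z e =
        inner ℝ (W.starProjection (EuclideanSpace.single e 1)) z := by
      rw [W.inner_starProjection_left_eq_right]
      simp [EuclideanSpace.inner_single_left]
    rw [hself, PiLp.inner_apply]
    simp [mul_comm]
  have hinner : ‖W.starProjection z‖ ^ 2 = inner ℝ z (W.starProjection z) := by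
    rw [← real_inner_self_eq_norm_sq,
      inner_starProjection_of_mem W z (W.starProjection_apply_mem z)]
  simp only [hinner, PiLp.inner_apply, hcoord, RCLike.inner_apply, conj_trivial, Finset.sum_mul]
  exact Finset.sum_congr rfl fun e _ => Finset.sum_congr rfl fun f _ => by ring

lemma integral_sq_norm_starProjection [IsFiniteMeasure P] {Y : Ω → EuclideanSpace ℝ ι}
    {m : EuclideanSpace ℝ ι} (hY : ∀ e, MemLp (fun ω => Y ω e) 2 P)
    (hm : ∀ e, ∫ ω, Y ω e ∂P = m e)
    (huncorr : Pairwise fun e f => cov[fun ω => Y ω e, fun ω => Y ω f; P] = 0) :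
    ∫ ω, ‖W.starProjection (Y ω - m)‖ ^ 2 ∂P =
      ∑ e, W.starProjection (EuclideanSpace.single e 1) e * Var[fun ω => Y ω e; P] := by
  have hL2 (e : ι) : MemLp (fun ω => (Y ω - m) e) 2 P := (hY e).sub (memLp_const (m e))
  have hint (e f : ι) : Integrable (fun ω => W.starProjection (EuclideanSpace.single e 1) f *
      ((Y ω - m) e * (Y ω - m) f)) P :=
    ((hL2 e).integrable_mul (hL2 f)).const_mul _
  have hcov (e f : ι) : ∫ ω, (Y ω - m) e * (Y ω - m) f ∂P =
      cov[fun ω => Y ω e, fun ω => Y ω f; P] := by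
    simp only [covariance, hm, PiLp.sub_apply]
  simp only [sq_norm_starProjection_eq_sum]
  rw [integral_finsetSum _ fun e _ => integrable_finsetSum _ fun f _ => hint e f]
  refine Finset.sum_congr rfl fun e _ => ?_
  rw [integral_finsetSum _ fun f _ => hint e f, Finset.sum_eq_single e]
  · rw [integral_const_mul, hcov, covariance_self (hY e).aemeasurable]
  · intro f _ hf
    rw [integral_const_mul, hcov, huncorr hf.symm, mul_zero]
  · simp

end Moments

section Arrivals

variable {n : ℕ} (arr : Fin n → Fin n → PMF ℕ)

instance : IsProbabilityMeasure (arrivalLaw arr) := by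
  unfold arrivalLaw; infer_instance

lemma hasLaw_arrivalLaw_row (i : Fin n) :
    HasLaw (fun a => a i) (Measure.pi fun j => (arr i j).toMeasure) (arrivalLaw arr) :=
  (measurePreserving_eval (fun i => Measure.pi fun j => (arr i j).toMeasure) i).hasLaw

lemma hasLaw_arrivalLaw_apply (i j : Fin n) :
    HasLaw (fun a => a i j) (arr i j).toMeasure (arrivalLaw arr) :=
  (measurePreserving_eval (fun j => (arr i j).toMeasure) j).hasLaw.comp
    (hasLaw_arrivalLaw_row arr i)

lemma iIndepFun_arrivalLaw :
    iIndepFun (fun (e : Fin n × Fin n) (a : QueueState n) => a e.1 e.2) (arrivalLaw arr) :=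
  iIndepFun_uncurry' (X := fun i j (a : QueueState n) => a i j) (fun _ _ => Measurable.of_discrete)
    ((iIndepFun_iff_hasLaw_pi_pi (hasLaw_arrivalLaw_row arr)).2 HasLaw.id)
    fun i => (iIndepFun_iff_hasLaw_pi_pi (hasLaw_arrivalLaw_apply arr i)).2
      (hasLaw_arrivalLaw_row arr i)

variable {arr} {b : ℕ} (harr : ∀ i j, ∀ a ∈ (arr i j).support, a ≤ b)

include harr

lemma ae_arrivalLaw_le : ∀ᵐ a ∂arrivalLaw arr, ∀ i j, a i j ≤ b := by
  refine ae_all_iff.2 fun i => ae_all_iff.2 fun j => ?_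
  rw [(hasLaw_arrivalLaw_apply arr i j).ae_iff (p := fun k => k ≤ b) Measurable.of_discrete, ae_iff,
    PMF.toMeasure_apply_eq_zero_iff _ MeasurableSet.of_discrete, Set.disjoint_left]
  exact fun k hk hk' => hk' (harr i j k hk)

lemma memLp_arrivalLaw_apply (i j : Fin n) :
    MemLp (fun a => (a i j : ℝ)) 2 (arrivalLaw arr) := by
  refine MemLp.of_bound Measurable.of_discrete.aestronglyMeasurable b ?_
  filter_upwards [ae_arrivalLaw_le harr] with a ha
  simpa using ha i j

end Arrivals

section StationarySwitch

variable {n : ℕ}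

/-- One time slot of a MaxWeight switch in steady state, realized on a probability space: queue
lengths `Q`, arrivals `A` of mean `lam` with entries at most `b`, and a schedule `S`. The schedule
enters only through `isMaxWeight` and `stationary`, so it need not be measurable. -/
structure IsStationarySwitch {Ω : Type*} [MeasurableSpace Ω] (P : Measure Ω)
    (Q A : Ω → QueueState n) (S : Ω → Equiv.Perm (Fin n)) (lam : Fin n → Fin n → ℝ) (b : ℕ) :
    Prop where
  measurable_queue : Measurable Q
  measurable_arrivals : Measurable A
  indepFun : IndepFun Q A P
  isMaxWeight : ∀ᵐ ω ∂P, IsMaxWeight (Q ω) (S ω)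
  arrivals_le : ∀ᵐ ω ∂P, ∀ i j, A ω i j ≤ b
  mean_arrivals : ∀ i j, ∫ ω, (A ω i j : ℝ) ∂P = lam i j
  stationary : IdentDistrib (fun ω => nextQueue (Q ω) (A ω) (S ω)) Q P P

local instance : MeasurableSpace (Equiv.Perm (Fin n)) := ⊤

/-- The kernel that draws a schedule from `rule q` in state `q`. -/
noncomputable def scheduleKernel (rule : QueueState n → PMF (Equiv.Perm (Fin n))) :
    Kernel (QueueState n) (Equiv.Perm (Fin n)) :=
  Kernel.ofFunOfCountable fun q => (rule q).toMeasure

variable {rule : QueueState n → PMF (Equiv.Perm (Fin n))}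

lemma scheduleKernel_apply (q : QueueState n) : scheduleKernel rule q = (rule q).toMeasure := rfl

instance : IsMarkovKernel (scheduleKernel rule) :=
  ⟨fun q => by rw [scheduleKernel_apply]; infer_instance⟩

variable {arr : Fin n → Fin n → PMF ℕ} {μ : Measure (QueueState n)}

lemma ae_isMaxWeight_compProd_scheduleKernel (hrule : IsMaxWeightRule rule) :
    ∀ᵐ z ∂μ ⊗ₘ scheduleKernel rule, IsMaxWeight z.1 z.2 := by
  refine (Measure.ae_compProd_iff MeasurableSet.of_discrete).2 (.of_forall fun q => ?_)
  rw [scheduleKernel_apply, ae_iff, PMF.toMeasure_apply_eq_zero_iff _ MeasurableSet.of_discrete,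
    Set.disjoint_left]
  exact fun s hs hs' => hs' (hrule q s hs)

lemma map_nextQueue_eq_of_invariant (hμ : Kernel.Invariant (queueKernel arr rule) μ) :
    ((μ ⊗ₘ scheduleKernel rule).prod (arrivalLaw arr)).map
      (fun z => nextQueue z.1.1 z.2 z.1.2) = μ := by
  ext t ht
  have hqueue (q) : queueKernel arr rule q = ∑ s : Equiv.Perm (Fin n),
    rule q s • (arrivalLaw arr).map fun a => nextQueue q a s := rfl
  rw [Measure.map_apply Measurable.of_discrete ht, Measure.prod_apply MeasurableSet.of_discrete,
    Measure.lintegral_compProd Measurable.of_discrete]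
  conv_rhs => rw [← hμ.def, Measure.bind_apply ht (Kernel.aemeasurable _)]
  refine lintegral_congr fun q => ?_
  rw [scheduleKernel_apply, lintegral_fintype, hqueue, Measure.finsetSum_apply]
  refine Finset.sum_congr rfl fun s _ => ?_
  rw [PMF.toMeasure_apply_singleton _ _ MeasurableSet.of_discrete, Measure.smul_apply, smul_eq_mul,
    Measure.map_apply Measurable.of_discrete ht, mul_comm]
  rfl

lemma exists_isStationarySwitch [IsProbabilityMeasure μ] {b : ℕ}
    (harr : ∀ i j, ∀ a ∈ (arr i j).support, a ≤ b) {lam : Fin n → Fin n → ℝ}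
    (hmean : ∀ i j, ∫ a, (a : ℝ) ∂(arr i j).toMeasure = lam i j) (hrule : IsMaxWeightRule rule)
    (hμ : Kernel.Invariant (queueKernel arr rule) μ) :
    ∃ (Ω : Type) (_ : MeasurableSpace Ω) (P : Measure Ω) (_ : IsProbabilityMeasure P)
      (Q A : Ω → QueueState n) (S : Ω → Equiv.Perm (Fin n)),
      HasLaw Q μ P ∧ HasLaw A (arrivalLaw arr) P ∧ IsStationarySwitch P Q A S lam b := by
  set ρ := μ ⊗ₘ scheduleKernel rule with hρ
  have hQ : HasLaw (fun z => z.1.1) μ (ρ.prod (arrivalLaw arr)) :=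
    HasLaw.comp (P := ρ.prod (arrivalLaw arr)) ⟨by fun_prop, Measure.fst_compProd μ _⟩
      measurePreserving_fst.hasLaw
  have hA : HasLaw Prod.snd (arrivalLaw arr) (ρ.prod (arrivalLaw arr)) :=
    measurePreserving_snd.hasLaw
  refine ⟨_, _, ρ.prod (arrivalLaw arr), inferInstance, fun z => z.1.1, fun z => z.2,
    fun z => z.1.2, hQ, hA,
    { measurable_queue := by fun_prop
      measurable_arrivals := by fun_prop
      indepFun := indepFun_prod (X := Prod.fst) (Y := id) measurable_fst measurable_id
      isMaxWeight := Measure.quasiMeasurePreserving_fst.ae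
        (ae_isMaxWeight_compProd_scheduleKernel hrule)
      arrivals_le := (hA.ae_iff Measurable.of_discrete).2 (ae_arrivalLaw_le harr)
      mean_arrivals := fun i j => by
        rw [← hmean]
        exact ((hasLaw_arrivalLaw_apply arr i j).comp hA).integral_comp
          Measurable.of_discrete.aestronglyMeasurable
      stationary := ⟨Measurable.of_discrete.aemeasurable, by fun_prop, ?_⟩ }⟩
  rw [hQ.map_eq, hρ, map_nextQueue_eq_of_invariant hμ]

end StationarySwitch

namespace IsStationarySwitch

variable {n : ℕ} {Ω : Type*} [MeasurableSpace Ω] {P : Measure Ω}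
  {Q A : Ω → QueueState n} {S : Ω → Equiv.Perm (Fin n)} {lam : Fin n → Fin n → ℝ} {b : ℕ}
  (h : IsStationarySwitch P Q A S lam b)

include h

lemma integrable_nextQueue_iff (f : QueueState n → ℝ) :
    Integrable (fun ω => f (nextQueue (Q ω) (A ω) (S ω))) P ↔ Integrable (fun ω => f (Q ω)) P :=
  (h.stationary.comp (u := f) Measurable.of_discrete).integrable_iff

lemma integral_nextQueue (f : QueueState n → ℝ) :
    ∫ ω, f (nextQueue (Q ω) (A ω) (S ω)) ∂P = ∫ ω, f (Q ω) ∂P :=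
  (h.stationary.comp (u := f) Measurable.of_discrete).integral_eq

lemma norm_natVec_arrivals_le : ∀ᵐ ω ∂P, ‖natVec (A ω)‖ ≤ n * b :=
  h.arrivals_le.mono fun _ => norm_natVec_le _

variable [IsProbabilityMeasure P]

lemma integrable_natVec_arrivals : Integrable (fun ω => natVec (A ω)) P :=
  have hmeas : Measurable (natVec ∘ A) := Measurable.of_discrete.comp h.measurable_arrivals
  .of_bound hmeas.aestronglyMeasurable _ h.norm_natVec_arrivals_le

lemma integral_natVec_arrivals : ∫ ω, natVec (A ω) ∂P = toVec lam := by
  ext e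
  exact ((EuclideanSpace.proj (𝕜 := ℝ) e).integral_comp_comm
    h.integrable_natVec_arrivals).symm.trans (h.mean_arrivals e.1 e.2)

lemma norm_arrivals_sub_le : ∀ᵐ ω ∂P, ‖natVec (A ω) - toVec lam‖ ≤ 2 * (n * b) := by
  have hlam : ‖toVec lam‖ ≤ n * b := by
    simpa [h.integral_natVec_arrivals] using
      norm_integral_le_of_norm_le_const h.norm_natVec_arrivals_le
  filter_upwards [h.norm_natVec_arrivals_le] with ω hω
  linarith [norm_sub_le (natVec (A ω)) (toVec lam)]

lemma integral_inner_arrivals_sub {F : QueueState n → MatrixSpace n}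
    (hF : Integrable (fun ω => F (Q ω)) P) :
    Integrable (fun ω => inner ℝ (F (Q ω)) (natVec (A ω) - toVec lam)) P ∧
      ∫ ω, inner ℝ (F (Q ω)) (natVec (A ω) - toVec lam) ∂P = 0 := by
  refine integrable_inner_and_integral_inner_eq_zero
    (h.indepFun.comp (φ := F) (ψ := fun a => natVec a - toVec lam) Measurable.of_discrete
      Measurable.of_discrete) hF (h.integrable_natVec_arrivals.sub (integrable_const _)) ?_
  simp [integral_sub h.integrable_natVec_arrivals, h.integral_natVec_arrivals]

lemma setIntegral_inner_arrivals_sub {F : QueueState n → MatrixSpace n} {s : Set (QueueState n)}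
    {K : ℝ} (hK : 0 ≤ K) (hF : ∀ q ∈ s, ‖F q‖ ≤ K) :
    IntegrableOn (fun ω => inner ℝ (F (Q ω)) (natVec (A ω) - toVec lam)) (Q ⁻¹' s) P ∧
      ∫ ω in Q ⁻¹' s, inner ℝ (F (Q ω)) (natVec (A ω) - toVec lam) ∂P = 0 := by
  classical
  have hs : MeasurableSet (Q ⁻¹' s) := h.measurable_queue MeasurableSet.of_discrete
  have hind : (Q ⁻¹' s).indicator (fun ω => inner ℝ (F (Q ω)) (natVec (A ω) - toVec lam)) =
      fun ω => inner ℝ (s.indicator F (Q ω)) (natVec (A ω) - toVec lam) := by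
    ext ω
    by_cases hω : Q ω ∈ s <;> simp [Set.indicator, hω]
  have hint : Integrable (fun ω => s.indicator F (Q ω)) P := by
    refine .of_bound ((Measurable.of_discrete (f := s.indicator F)).comp
      h.measurable_queue).aestronglyMeasurable K
      (.of_forall fun ω => ?_)
    by_cases hω : Q ω ∈ s
    · simpa [hω] using hF _ hω
    · simpa [hω] using hK
  rw [← integrable_indicator_iff hs, ← integral_indicator hs, hind]
  exact h.integral_inner_arrivals_sub hint

end IsStationarySwitch

section StateSpaceCollapse

variable {n : ℕ} {Ω : Type*} [MeasurableSpace Ω] {P : Measure Ω} [IsProbabilityMeasure P]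
  {Q A : Ω → QueueState n} {S : Ω → Equiv.Perm (Fin n)} {ν : Fin n → Fin n → ℝ} {ε δ : ℝ} {b : ℕ}
  {R C : Finset (Fin n)}

/-- A bound, uniform in the load, for the third moment of the component of the queue lengths
perpendicular to the cone of state space collapse, when MaxWeight drives it back at rate `δ`. -/
noncomputable def collapseBound (n b : ℕ) (δ : ℝ) : ℝ :=
  ((2 * (n * (b + 2)) ^ 2 + 2 * (2 * (2 * (n * b)) + δ) ^ 2) ^ 3 / δ ^ 2 +
    2 * (n * (b + 2)) ^ 4) / δ

theorem IsStationarySwitch.integral_norm_coneProj_pow_three_le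
    (h : IsStationarySwitch P Q A S (fun i j => (1 - ε) * ν i j) b)
    (hdrift : ∀ q s, IsMaxWeight q s →
      inner ℝ (coneProj (polarCone R C) (natVec q)) (toVec ν - natVec (scheduleMatrix s)) ≤
        -δ * ‖coneProj (polarCone R C) (natVec q)‖)
    (hδ : 0 < δ) (hε : 0 ≤ ε) (hεδ : ε * ‖toVec ν‖ ≤ δ / 2) :
    Integrable (fun ω => ‖coneProj (polarCone R C) (natVec (Q ω))‖ ^ 3) P ∧
      ∫ ω, ‖coneProj (polarCone R C) (natVec (Q ω))‖ ^ 3 ∂P ≤ collapseBound n b δ := by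
  set p : QueueState n → MatrixSpace n := fun q => coneProj (polarCone R C) (natVec q)
  have hmeas (f : QueueState n → ℝ) : Measurable fun ω => f (Q ω) :=
    Measurable.of_discrete.comp h.measurable_queue
  have hmart (k : ℕ) := h.setIntegral_inner_arrivals_sub (F := fun q => (4 * ‖p q‖ ^ 2) • p q)
    (s := {q | ‖p q‖ ^ 4 ≤ k}) (K := 4 * (k + 1)) (by positivity) fun q hq => by
      rw [norm_smul, Real.norm_of_nonneg (by positivity)]
      have hq : ‖p q‖ ^ 4 ≤ k := hq
      nlinarith [norm_nonneg (p q), sq_nonneg (‖p q‖ ^ 2 - ‖p q‖), sq_nonneg (‖p q‖ - 1),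
        sq_nonneg (‖p q‖ ^ 2 - 1)]
  have hlam : toVec (fun i j => (1 - ε) * ν i j) = (1 - ε) • toVec ν := rfl
  obtain ⟨hint, hle⟩ := integrable_and_integral_le_of_drift
    (V := fun ω => ‖p (Q ω)‖ ^ 4) (g := fun ω => δ * ‖p (Q ω)‖ ^ 3) (K := collapseBound n b δ * δ)
    (hmeas fun q => ‖p q‖ ^ 4) (.of_forall fun ω => by positivity)
    (h.stationary.comp (u := fun q => ‖p q‖ ^ 4) Measurable.of_discrete)
    (hmeas fun q => δ * ‖p q‖ ^ 3).aestronglyMeasurable (.of_forall fun ω => by positivity)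
    (by unfold collapseBound; positivity) (fun k => (hmart k).1) (fun k => (hmart k).2) (by
      filter_upwards [h.isMaxWeight, h.arrivals_le, h.norm_arrivals_sub_le] with ω hs ha hc
      have hx : |inner ℝ (p (Q ω)) (natVec (A ω) - (1 - ε) • toVec ν)| ≤
          2 * (n * b) * ‖p (Q ω)‖ :=
        (abs_real_inner_le_norm _ _).trans (by rw [mul_comm]; gcongr; exact hc)
      have h4 := pow_four_le_of_sq_le (norm_nonneg _) hδ hx
        (sq_norm_coneProj_nextQueue_le (hdrift _ _ hs) hε hεδ ha)
      rw [collapseBound, div_mul_cancel₀ _ hδ.ne', inner_smul_left, hlam]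
      simpa using h4)
  rw [integrable_const_mul_iff (Ne.isUnit hδ.ne')] at hint
  rw [integral_const_mul, mul_comm] at hle
  exact ⟨hint, le_of_mul_le_mul_right hle hδ⟩

theorem IsStationarySwitch.integral_norm_coneProj_pow_le
    (h : IsStationarySwitch P Q A S (fun i j => (1 - ε) * ν i j) b)
    (hdrift : ∀ q s, IsMaxWeight q s →
      inner ℝ (coneProj (polarCone R C) (natVec q)) (toVec ν - natVec (scheduleMatrix s)) ≤
        -δ * ‖coneProj (polarCone R C) (natVec q)‖)
    (hδ : 0 < δ) (hε : 0 ≤ ε) (hεδ : ε * ‖toVec ν‖ ≤ δ / 2) {k : ℕ} (hk : k ≤ 3) :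
    Integrable (fun ω => ‖coneProj (polarCone R C) (natVec (Q ω))‖ ^ k) P ∧
      ∫ ω, ‖coneProj (polarCone R C) (natVec (Q ω))‖ ^ k ∂P ≤ 1 + collapseBound n b δ := by
  obtain ⟨hint, hle⟩ := h.integral_norm_coneProj_pow_three_le hdrift hδ hε hεδ
  have hmeas : Measurable ((fun q => ‖coneProj (polarCone R C) (natVec q)‖) ∘ Q) :=
    Measurable.of_discrete.comp h.measurable_queue
  obtain ⟨hint', hle'⟩ := integrable_pow_and_integral_pow_le hmeas.aestronglyMeasurable
    (fun _ => norm_nonneg _) hk hint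
  exact ⟨hint', hle'.trans (add_le_add_right hle 1)⟩

end StateSpaceCollapse

section PortCount

variable {n : ℕ} {R C : Finset (Fin n)}

/-- The number of ports of each queue, among its row and its column, that lie in `R` and `C`. It
weighs the unused service that the saturated ports see. -/
noncomputable def portCount (R C : Finset (Fin n)) : MatrixSpace n :=
  toVec fun i j => (if i ∈ R then 1 else 0) + if j ∈ C then 1 else 0

lemma portCount_mem_portSpace : portCount R C ∈ portSpace R C :=
  toVec_add_mem_portSpace (fun _ hi => if_neg hi) fun _ hj => if_neg hj

lemma one_le_portCount_apply {i j : Fin n} (hij : i ∈ R ∨ j ∈ C) : 1 ≤ portCount R C (i, j) := by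
  rw [portCount, toVec_apply]
  rcases hij with h | h <;> simp only [h, if_true] <;> split_ifs <;> norm_num

lemma portCount_apply_mem_Icc (e : Fin n × Fin n) : portCount R C e ∈ Set.Icc 0 2 := by
  rw [portCount, toVec_apply]
  split_ifs <;> norm_num

lemma abs_inner_le_mul_inner_portCount {y u : MatrixSpace n} {c : ℝ} (hy : y ∈ portSpace R C)
    (hc : 0 ≤ c) (hu : ∀ e, 0 ≤ u e) (hyu : ∀ e, |y e * u e| ≤ c * u e) :
    |inner ℝ y u| ≤ c * inner ℝ (portCount R C) u := by
  simp only [inner_eq_sum, Finset.mul_sum]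
  refine (Finset.abs_sum_le_sum_abs _ _).trans (Finset.sum_le_sum fun i _ =>
    (Finset.abs_sum_le_sum_abs _ _).trans (Finset.sum_le_sum fun j _ => ?_))
  have hcu := mul_nonneg hc (hu (i, j))
  by_cases hij : i ∈ R ∨ j ∈ C
  · calc _ ≤ c * u (i, j) := hyu _
      _ ≤ portCount R C (i, j) * (c * u (i, j)) :=
        le_mul_of_one_le_left hcu (one_le_portCount_apply hij)
      _ = _ := by ring
  · rw [not_or] at hij
    rw [portSpace_apply_eq_zero hy hij.1 hij.2, zero_mul, abs_zero, mul_left_comm]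
    exact mul_nonneg (portCount_apply_mem_Icc _).1 hcu

variable (R C) (q a : QueueState n) (s : Equiv.Perm (Fin n))

lemma inner_portCount_unusedService_nonneg :
    0 ≤ inner ℝ (portCount R C) (natVec (unusedService q a s)) := by
  rw [inner_eq_sum]
  exact Finset.sum_nonneg fun i _ => Finset.sum_nonneg fun j _ =>
    mul_nonneg (portCount_apply_mem_Icc _).1 (Nat.cast_nonneg _)

lemma inner_portCount_unusedService_le :
    inner ℝ (portCount R C) (natVec (unusedService q a s)) ≤ 2 * (n : ℝ) ^ 2 := by
  have hu (e : Fin n × Fin n) : natVec (unusedService q a s) e ≤ 1 :=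
    Nat.cast_le_one.2 (unusedService_le_one q a s e.1 e.2)
  have hle (e : Fin n × Fin n) : portCount R C e * natVec (unusedService q a s) e ≤ 2 * 1 :=
    mul_le_mul (portCount_apply_mem_Icc e).2 (hu e) (Nat.cast_nonneg _) zero_le_two
  rw [inner_eq_sum]
  calc _ ≤ ∑ _i : Fin n, ∑ _j : Fin n, (2 * 1 : ℝ) :=
        Finset.sum_le_sum fun i _ => Finset.sum_le_sum fun j _ => hle (i, j)
    _ = _ := by simp; ring

lemma abs_inner_starProjection_nextQueue_le :
    |inner ℝ ((portSpace R C).starProjection (natVec (nextQueue q a s)))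
        (natVec (unusedService q a s))| ≤
      ‖coneProj (polarCone R C) (natVec (nextQueue q a s))‖ *
        inner ℝ (portCount R C) (natVec (unusedService q a s)) := by
  set x := natVec (nextQueue q a s)
  set u := natVec (unusedService q a s)
  have hu (e) : 0 ≤ u e := Nat.cast_nonneg _
  refine abs_inner_le_mul_inner_portCount (Submodule.starProjection_apply_mem _ _) (norm_nonneg _)
    hu fun e => ?_
  have hxu : x e * u e = 0 := natVec_nextQueue_mul_unusedService q a s e
  have hproj : (portSpace R C).starProjection x e * u e =
      -((x - (portSpace R C).starProjection x) e * u e) := by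
    rw [PiLp.sub_apply, sub_mul, hxu]; ring
  rw [hproj, abs_neg, abs_mul, abs_of_nonneg (hu e)]
  gcongr
  · exact hu e
  · exact (PiLp.norm_apply_le _ e).trans
      (norm_sub_starProjection_le (fun _ => orthogonal_portSpace_subset_polarCone) x)

lemma sq_norm_starProjection_unusedService_le :
    ‖(portSpace R C).starProjection (natVec (unusedService q a s))‖ ^ 2 ≤
      n * inner ℝ (portCount R C) (natVec (unusedService q a s)) := by
  set u := natVec (unusedService q a s)
  have hu (e) : 0 ≤ u e := Nat.cast_nonneg _
  have hself : ‖(portSpace R C).starProjection u‖ ^ 2 =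
      inner ℝ ((portSpace R C).starProjection u) u := by
    rw [← real_inner_self_eq_norm_sq,
      inner_starProjection_of_mem _ _ (Submodule.starProjection_apply_mem _ u), real_inner_comm]
  rw [hself]
  refine (le_abs_self _).trans (abs_inner_le_mul_inner_portCount
    (Submodule.starProjection_apply_mem _ _) (Nat.cast_nonneg n) hu fun e => ?_)
  rw [abs_mul, abs_of_nonneg (hu e)]
  gcongr
  · exact hu e
  · calc _ ≤ ‖(portSpace R C).starProjection u‖ := PiLp.norm_apply_le _ e
      _ ≤ ‖u‖ := Submodule.norm_starProjection_apply_le _ u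
      _ ≤ n := by simpa using norm_natVec_le _ (unusedService_le_one q a s)

lemma abs_two_mul_inner_sub_sq_norm_le {η : ℝ} (hη : 0 < η) :
    |2 * inner ℝ ((portSpace R C).starProjection (natVec (nextQueue q a s)))
          (natVec (unusedService q a s)) -
        ‖(portSpace R C).starProjection (natVec (unusedService q a s))‖ ^ 2| ≤
      η * ‖coneProj (polarCone R C) (natVec (nextQueue q a s))‖ ^ 2 +
        (2 * (n : ℝ) ^ 2 / η + n) * inner ℝ (portCount R C) (natVec (unusedService q a s)) := by
  have hinner := abs_inner_starProjection_nextQueue_le R C q a s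
  have hsq := sq_norm_starProjection_unusedService_le R C q a s
  have hN₀ := inner_portCount_unusedService_nonneg R C q a s
  have hN₁ := inner_portCount_unusedService_le R C q a s
  set N := inner ℝ (portCount R C) (natVec (unusedService q a s))
  set d := ‖coneProj (polarCone R C) (natVec (nextQueue q a s))‖
  have hyoung : 2 * (d * N) ≤ η * d ^ 2 + 2 * (n : ℝ) ^ 2 / η * N :=
    calc 2 * (d * N) ≤ η * d ^ 2 + N * N / η := by
          have : 0 ≤ (η * d - N) ^ 2 / η := by positivity
          have : (η * d - N) ^ 2 / η = η * d ^ 2 - 2 * (d * N) + N * N / η := by field_simp; ring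
          linarith
      _ ≤ η * d ^ 2 + 2 * (n : ℝ) ^ 2 * N / η := by gcongr
      _ = _ := by ring
  rw [abs_le] at hinner ⊢
  constructor <;>
    linarith [sq_nonneg ‖(portSpace R C).starProjection (natVec (unusedService q a s))‖]

end PortCount

namespace SaturatesExactly

variable {n : ℕ} {R C : Finset (Fin n)} {ν : Fin n → Fin n → ℝ} (hν : SaturatesExactly R C ν)

include hν

lemma one_sub_mul {ε : ℝ} (hε₀ : 0 < ε) (hε₁ : ε < 1) :
    SaturatesExactly ∅ ∅ fun i j => (1 - ε) * ν i j := by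
  have hlt {x : ℝ} (hx : x ≤ 1) : (1 - ε) * x < 1 := by nlinarith
  have hrow (i) : ∑ j, ν i j ≤ 1 := by
    by_cases hi : i ∈ R
    · exact (hν.row_eq i hi).le
    · exact (hν.row_lt i hi).le
  have hcol (j) : ∑ i, ν i j ≤ 1 := by
    by_cases hj : j ∈ C
    · exact (hν.col_eq j hj).le
    · exact (hν.col_lt j hj).le
  constructor
  case pos => exact fun i j => mul_pos (sub_pos.2 hε₁) (hν.pos i j)
  case row_lt => exact fun i _ => by simpa [Finset.mul_sum] using hlt (hrow i)
  case col_lt => exact fun j _ => by simpa [Finset.mul_sum] using hlt (hcol j)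
  all_goals simp

variable {y : MatrixSpace n} (hy : y ∈ portSpace R C)

include hy in
lemma inner_natVec_one : inner ℝ y (natVec fun _ _ => 1) = n * inner ℝ y (toVec ν) := by
  have horth : natVec (fun _ _ => 1) - (n : ℝ) • toVec ν ∈ (portSpace R C)ᗮ := by
    rw [mem_orthogonal_portSpace]
    constructor
    · intro i hi
      simp [Finset.sum_sub_distrib, ← Finset.mul_sum, hν.row_eq i hi]
    · intro j hj
      simp [Finset.sum_sub_distrib, ← Finset.mul_sum, hν.col_eq j hj]
  have h := Submodule.inner_right_of_mem_orthogonal hy horth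
  rwa [inner_sub_right, inner_smul_right, sub_eq_zero] at h

variable (ε : ℝ) (q a : QueueState n) (s : Equiv.Perm (Fin n))

include hy in
lemma inner_unusedService : inner ℝ y (natVec (unusedService q a s)) =
    inner ℝ y (natVec (nextQueue q a s)) - inner ℝ y (natVec q)
      - inner ℝ y (natVec a - (1 - ε) • toVec ν) + ε * inner ℝ y (toVec ν) := by
  have h := Submodule.inner_right_of_mem_orthogonal hy (hν.sub_mem_orthogonal s)
  rw [inner_sub_right, sub_eq_zero] at h
  rw [natVec_nextQueue, inner_add_right, inner_sub_right, inner_add_right, inner_sub_right,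
    inner_smul_right, h]
  ring

lemma two_mul_inner_unusedService_sub_sq_norm :
    2 * inner ℝ ((portSpace R C).starProjection (natVec (nextQueue q a s)))
          (natVec (unusedService q a s)) -
        ‖(portSpace R C).starProjection (natVec (unusedService q a s))‖ ^ 2 =
      ‖(portSpace R C).starProjection (natVec (nextQueue q a s))‖ ^ 2
        - ‖(portSpace R C).starProjection (natVec q)‖ ^ 2
        + 2 * ε * inner ℝ ((portSpace R C).starProjection (natVec q)) (toVec ν)
        - ε ^ 2 * ‖(portSpace R C).starProjection (toVec ν)‖ ^ 2
        - 2 * inner ℝ ((portSpace R C).starProjection (natVec q - ε • toVec ν))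
          (natVec a - (1 - ε) • toVec ν)
        - ‖(portSpace R C).starProjection (natVec a - (1 - ε) • toVec ν)‖ ^ 2 := by
  set T := (portSpace R C).starProjection
  have hinner (x z) : inner ℝ (T x) z = inner ℝ (T x) (T z) := by
    rw [real_inner_comm, real_inner_comm (T z),
      inner_starProjection_of_mem _ _ (Submodule.starProjection_apply_mem _ x)]
  have hs : T (natVec (scheduleMatrix s)) = T (toVec ν) := by
    have h := (Submodule.starProjection_apply_eq_zero_iff _).2 (hν.sub_mem_orthogonal s)
    rwa [map_sub, sub_eq_zero, eq_comm] at h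
  have hnext : T (natVec (nextQueue q a s)) - T (natVec (unusedService q a s)) =
      T (natVec q - ε • toVec ν) + T (natVec a - (1 - ε) • toVec ν) := by
    rw [natVec_nextQueue]
    simp only [map_add, map_sub, map_smul, hs]
    module
  have hsq := congrArg (‖·‖ ^ 2) hnext
  simp only [norm_sub_sq_real, norm_add_sq_real] at hsq
  have hshift : ‖T (natVec q - ε • toVec ν)‖ ^ 2 = ‖T (natVec q)‖ ^ 2
      - 2 * ε * inner ℝ (T (natVec q)) (T (toVec ν)) + ε ^ 2 * ‖T (toVec ν)‖ ^ 2 := by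
    rw [map_sub, map_smul, norm_sub_sq_real, inner_smul_right, norm_smul, mul_pow,
      Real.norm_eq_abs, sq_abs]
    ring
  rw [hinner _ (natVec (unusedService q a s)), hinner _ (toVec ν),
    hinner _ (natVec a - (1 - ε) • toVec ν)]
  linarith

end SaturatesExactly

section HeavyTraffic

variable {n : ℕ} {Ω : Type*} [MeasurableSpace Ω] {P : Measure Ω} [IsProbabilityMeasure P]
  {Q A : Ω → QueueState n} {S : Ω → Equiv.Perm (Fin n)} {ν : Fin n → Fin n → ℝ} {ε : ℝ} {b : ℕ}
  {R C : Finset (Fin n)}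

namespace IsStationarySwitch

lemma memLp_natVec_queue {lam : Fin n → Fin n → ℝ} (h : IsStationarySwitch P Q A S lam b)
    (hlam : SaturatesExactly ∅ ∅ lam) : MemLp (fun ω => natVec (Q ω)) 2 P := by
  obtain ⟨δ, hδ, hdrift⟩ := hlam.exists_inner_coneProj_sub_le
  have h₀ : IsStationarySwitch P Q A S (fun i j => (1 - 0) * lam i j) b := by simpa using h
  have hint := (h₀.integral_norm_coneProj_pow_le hdrift hδ le_rfl (by linarith)
    (by norm_num : 2 ≤ 3)).1
  simp only [polarCone_empty, coneProj_top] at hint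
  have hmeas : Measurable (natVec ∘ Q) := Measurable.of_discrete.comp h.measurable_queue
  exact (memLp_two_iff_integrable_sq_norm hmeas.aestronglyMeasurable).2 hint

variable (h : IsStationarySwitch P Q A S (fun i j => (1 - ε) * ν i j) b)
  (hν : SaturatesExactly R C ν) (hQ : MemLp (fun ω => natVec (Q ω)) 2 P)

include h hν hQ

lemma integral_inner_unusedService {y : MatrixSpace n} (hy : y ∈ portSpace R C) :
    Integrable (fun ω => inner ℝ y (natVec (unusedService (Q ω) (A ω) (S ω)))) P ∧
      ∫ ω, inner ℝ y (natVec (unusedService (Q ω) (A ω) (S ω))) ∂P = ε * inner ℝ y (toVec ν) := by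
  have hQy : Integrable (fun ω => inner ℝ y (natVec (Q ω))) P :=
    (hQ.integrable one_le_two).const_inner y
  have hQ'y : Integrable (fun ω => inner ℝ y (natVec (nextQueue (Q ω) (A ω) (S ω)))) P :=
    (h.integrable_nextQueue_iff fun q => inner ℝ y (natVec q)).2 hQy
  obtain ⟨hA, hA₀⟩ := h.integral_inner_arrivals_sub (F := fun _ => y) (integrable_const y)
  simp only [show toVec (fun i j => (1 - ε) * ν i j) = (1 - ε) • toVec ν from rfl] at hA hA₀
  simp only [hν.inner_unusedService hy ε]
  refine ⟨by fun_prop, ?_⟩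
  rw [integral_add (by fun_prop) (by fun_prop), integral_sub (by fun_prop) hA,
    integral_sub hQ'y hQy, hA₀,
    h.integral_nextQueue fun q => inner ℝ y (natVec q)]
  simp

lemma integral_two_mul_inner_unusedService_sub_sq_norm :
    ∫ ω, (2 * inner ℝ ((portSpace R C).starProjection (natVec (nextQueue (Q ω) (A ω) (S ω))))
          (natVec (unusedService (Q ω) (A ω) (S ω))) -
        ‖(portSpace R C).starProjection (natVec (unusedService (Q ω) (A ω) (S ω)))‖ ^ 2) ∂P =
      2 * ε * ∫ ω, inner ℝ ((portSpace R C).starProjection (natVec (Q ω))) (toVec ν) ∂P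
        - ε ^ 2 * ‖(portSpace R C).starProjection (toVec ν)‖ ^ 2
        - ∫ ω, ‖(portSpace R C).starProjection (natVec (A ω) - (1 - ε) • toVec ν)‖ ^ 2 ∂P := by
  set T := (portSpace R C).starProjection with hT
  have hlam : toVec (fun i j => (1 - ε) * ν i j) = (1 - ε) • toVec ν := rfl
  have hTQ : MemLp (fun ω => T (natVec (Q ω))) 2 P := T.comp_memLp' hQ
  have hTA : MemLp (fun ω => T (natVec (A ω) - (1 - ε) • toVec ν)) 2 P :=
    T.comp_memLp' (.of_bound (h.integrable_natVec_arrivals.1.sub aestronglyMeasurable_const) _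
      h.norm_arrivals_sub_le)
  have hsq : Integrable (fun ω => ‖T (natVec (Q ω))‖ ^ 2) P := hTQ.integrable_norm_pow two_ne_zero
  have hsq' : Integrable (fun ω => ‖T (natVec (nextQueue (Q ω) (A ω) (S ω)))‖ ^ 2) P :=
    (h.integrable_nextQueue_iff fun q => ‖T (natVec q)‖ ^ 2).2 hsq
  have hvar := hTA.integrable_norm_pow two_ne_zero
  have hinner : Integrable (fun ω => inner ℝ (T (natVec (Q ω))) (toVec ν)) P :=
    (hTQ.integrable one_le_two).inner_const _
  obtain ⟨hA, hA₀⟩ := h.integral_inner_arrivals_sub (F := fun q => T (natVec q - ε • toVec ν))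
    (T.integrable_comp ((hQ.integrable one_le_two).sub (integrable_const _)))
  rw [hlam] at hA hA₀
  simp only [hT, hν.two_mul_inner_unusedService_sub_sq_norm ε]
  rw [← hT, integral_sub (by fun_prop) hvar, integral_sub (by fun_prop) (by fun_prop),
    integral_sub (by fun_prop) (by fun_prop), integral_add (by fun_prop) (by fun_prop),
    integral_sub hsq' hsq, h.integral_nextQueue fun q => ‖T (natVec q)‖ ^ 2,
    integral_const_mul, integral_const_mul, integral_const_mul, hA₀]
  simp

include h hν hQ

lemma abs_two_mul_integral_inner_sub_le {η : ℝ} (hη : 0 < η)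
    (hp : Integrable (fun ω => ‖coneProj (polarCone R C) (natVec (Q ω))‖ ^ 2) P) :
    |2 * ε * ∫ ω, inner ℝ ((portSpace R C).starProjection (natVec (Q ω))) (toVec ν) ∂P
        - ε ^ 2 * ‖(portSpace R C).starProjection (toVec ν)‖ ^ 2
        - ∫ ω, ‖(portSpace R C).starProjection (natVec (A ω) - (1 - ε) • toVec ν)‖ ^ 2 ∂P| ≤
      η * ∫ ω, ‖coneProj (polarCone R C) (natVec (Q ω))‖ ^ 2 ∂P +
        (2 * (n : ℝ) ^ 2 / η + n) * (ε * inner ℝ (portCount R C) (toVec ν)) := by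
  have hp' := (h.integrable_nextQueue_iff fun q => ‖coneProj (polarCone R C) (natVec q)‖ ^ 2).2 hp
  obtain ⟨hN, hNε⟩ := h.integral_inner_unusedService hν hQ portCount_mem_portSpace
  rw [← h.integral_two_mul_inner_unusedService_sub_sq_norm hν hQ, ← Real.norm_eq_abs]
  refine (norm_integral_le_of_norm_le ((hp'.const_mul η).add (hN.const_mul _))
    (.of_forall fun ω => abs_two_mul_inner_sub_sq_norm_le R C _ _ _ hη)).trans_eq ?_
  rw [integral_add' (hp'.const_mul η) (hN.const_mul _), integral_const_mul, integral_const_mul, hNε,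
    h.integral_nextQueue fun q => ‖coneProj (polarCone R C) (natVec q)‖ ^ 2]

end IsStationarySwitch

lemma integrable_queue_apply (hQ : MemLp (fun ω => natVec (Q ω)) 2 P) (i j : Fin n) :
    Integrable (fun ω => (Q ω i j : ℝ)) P :=
  (EuclideanSpace.proj (𝕜 := ℝ) (i, j)).integrable_comp (hQ.integrable one_le_two)

lemma SaturatesExactly.abs_integral_sum_sub_le (hν : SaturatesExactly R C ν)
    (hQ : MemLp (fun ω => natVec (Q ω)) 2 P)
    (hp : Integrable (fun ω => ‖coneProj (polarCone R C) (natVec (Q ω))‖) P) :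
    |∫ ω, ∑ i, ∑ j, (Q ω i j : ℝ) ∂P -
        n * ∫ ω, inner ℝ ((portSpace R C).starProjection (natVec (Q ω))) (toVec ν) ∂P| ≤
      n * ∫ ω, ‖coneProj (polarCone R C) (natVec (Q ω))‖ ∂P := by
  set T := (portSpace R C).starProjection
  have hsum : Integrable (fun ω => ∑ i, ∑ j, (Q ω i j : ℝ)) P :=
    integrable_finsetSum _ fun i _ => integrable_finsetSum _ fun j _ =>
      integrable_queue_apply hQ i j
  have hT : Integrable (fun ω => inner ℝ (T (natVec (Q ω))) (toVec ν)) P :=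
    (T.integrable_comp (hQ.integrable one_le_two)).inner_const _
  have hle (q : QueueState n) : |∑ i, ∑ j, (q i j : ℝ) - n * inner ℝ (T (natVec q)) (toVec ν)| ≤
      n * ‖coneProj (polarCone R C) (natVec q)‖ :=
    calc _ = |inner ℝ (natVec q - T (natVec q)) (natVec fun _ _ => 1)| := by
          rw [inner_sub_left, hν.inner_natVec_one (Submodule.starProjection_apply_mem _ _),
            inner_eq_sum (natVec q)]
          simp only [natVec_apply, Nat.cast_one, mul_one, T]
      _ ≤ ‖natVec q - T (natVec q)‖ * ‖natVec fun (_ _ : Fin n) => 1‖ := abs_real_inner_le_norm _ _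
      _ ≤ ‖coneProj (polarCone R C) (natVec q)‖ * n := by
          gcongr
          · exact norm_sub_starProjection_le (fun _ => orthogonal_portSpace_subset_polarCone) _
          · simpa using norm_natVec_le (fun (_ _ : Fin n) => 1) (b := 1) fun _ _ => le_rfl
      _ = _ := mul_comm _ _
  rw [← integral_const_mul, ← integral_const_mul, ← integral_sub hsum (hT.const_mul _),
    ← Real.norm_eq_abs]
  exact norm_integral_le_of_norm_le (hp.const_mul _) (.of_forall fun ω => hle (Q ω))

lemma integral_queue_apply_le (hQ : MemLp (fun ω => natVec (Q ω)) 2 P)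
    (hp : Integrable (fun ω => ‖coneProj (polarCone R C) (natVec (Q ω))‖) P) {i j : Fin n}
    (hi : i ∉ R) (hj : j ∉ C) :
    ∫ ω, (Q ω i j : ℝ) ∂P ≤ ∫ ω, ‖coneProj (polarCone R C) (natVec (Q ω))‖ ∂P := by
  refine integral_mono (integrable_queue_apply hQ i j) hp fun ω => ?_
  set x := natVec (Q ω) with hx
  have hzero : (portSpace R C).starProjection x (i, j) = 0 :=
    portSpace_apply_eq_zero (Submodule.starProjection_apply_mem _ _) hi hj
  calc (Q ω i j : ℝ) = (x - (portSpace R C).starProjection x) (i, j) := by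
        rw [PiLp.sub_apply, hzero, sub_zero, hx, natVec_apply]
    _ ≤ ‖x - (portSpace R C).starProjection x‖ :=
        (le_abs_self _).trans (PiLp.norm_apply_le (x - (portSpace R C).starProjection x) (i, j))
    _ ≤ _ := norm_sub_starProjection_le (fun _ => orthogonal_portSpace_subset_polarCone) _

theorem IsStationarySwitch.abs_mul_integral_sum_sub_le
    (h : IsStationarySwitch P Q A S (fun i j => (1 - ε) * ν i j) b)
    (hν : SaturatesExactly R C ν) (hQ : MemLp (fun ω => natVec (Q ω)) 2 P)
    (hε₀ : 0 < ε) (hε₁ : ε ≤ 1) {M : ℝ}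
    (hp₁ : Integrable (fun ω => ‖coneProj (polarCone R C) (natVec (Q ω))‖) P)
    (hM₁ : ∫ ω, ‖coneProj (polarCone R C) (natVec (Q ω))‖ ∂P ≤ M)
    (hp₂ : Integrable (fun ω => ‖coneProj (polarCone R C) (natVec (Q ω))‖ ^ 2) P)
    (hM₂ : ∫ ω, ‖coneProj (polarCone R C) (natVec (Q ω))‖ ^ 2 ∂P ≤ M) :
    |ε * ∫ ω, ∑ i, ∑ j, (Q ω i j : ℝ) ∂P - n / 2 *
        ∫ ω, ‖(portSpace R C).starProjection (natVec (A ω) - (1 - ε) • toVec ν)‖ ^ 2 ∂P| ≤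
      (n * M + n / 2 * (‖(portSpace R C).starProjection (toVec ν)‖ ^ 2 + M +
        (2 * (n : ℝ) ^ 2 + n) * inner ℝ (portCount R C) (toVec ν))) * √ε := by
  have hsum := hν.abs_integral_sum_sub_le hQ hp₁
  have hdrift := h.abs_two_mul_integral_inner_sub_le hν hQ (Real.sqrt_pos.2 hε₀) hp₂
  have hc : 0 ≤ inner ℝ (portCount R C) (toVec ν) := by
    rw [inner_eq_sum]
    exact Finset.sum_nonneg fun i _ => Finset.sum_nonneg fun j _ =>
      mul_nonneg (portCount_apply_mem_Icc _).1 (hν.pos i j).le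
  set c := inner ℝ (portCount R C) (toVec ν)
  set τ := ‖(portSpace R C).starProjection (toVec ν)‖ ^ 2
  set V := ∫ ω, ‖(portSpace R C).starProjection (natVec (A ω) - (1 - ε) • toVec ν)‖ ^ 2 ∂P
  set X := ∫ ω, ∑ i, ∑ j, (Q ω i j : ℝ) ∂P
  set I := ∫ ω, inner ℝ ((portSpace R C).starProjection (natVec (Q ω))) (toVec ν) ∂P
  have hε_le : ε ≤ √ε := Real.le_sqrt_of_sq_le (by nlinarith)
  have hεsq : ε ^ 2 ≤ √ε := by nlinarith
  have hcoef : (2 * (n : ℝ) ^ 2 / √ε + n) * (ε * c) ≤ (2 * (n : ℝ) ^ 2 + n) * c * √ε :=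
    calc _ = (2 * (n : ℝ) ^ 2 * (ε / √ε) + n * ε) * c := by ring
      _ ≤ (2 * (n : ℝ) ^ 2 * √ε + n * √ε) * c := by rw [Real.div_sqrt]; gcongr
      _ = _ := by ring
  calc |ε * X - n / 2 * V|
      = |ε * (X - n * I) + n / 2 * (ε ^ 2 * τ + (2 * ε * I - ε ^ 2 * τ - V))| := by ring_nf
    _ ≤ |ε * (X - n * I)| + |n / 2 * (ε ^ 2 * τ + (2 * ε * I - ε ^ 2 * τ - V))| := abs_add_le _ _
    _ ≤ ε * |X - n * I| + n / 2 * (ε ^ 2 * τ + |2 * ε * I - ε ^ 2 * τ - V|) := by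
        rw [abs_mul, abs_mul, abs_of_pos hε₀, abs_of_nonneg (by positivity : (0 : ℝ) ≤ n / 2)]
        gcongr
        exact (abs_add_le _ _).trans_eq (by rw [abs_of_nonneg (by positivity)])
    _ ≤ √ε * (n * M) + n / 2 * (√ε * τ + (√ε * M + (2 * (n : ℝ) ^ 2 + n) * c * √ε)) := by
        gcongr
        · exact hsum.trans (by gcongr)
        · exact hdrift.trans (by gcongr)
    _ = _ := by ring

end HeavyTraffic

section StationaryDistribution

variable {n : ℕ} {R C : Finset (Fin n)} {ν : Fin n → Fin n → ℝ} {b : ℕ}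

lemma integral_sq_norm_starProjection_arrivalLaw {arr : Fin n → Fin n → PMF ℕ}
    {lam : Fin n → Fin n → ℝ} (harr : ∀ i j, ∀ a ∈ (arr i j).support, a ≤ b)
    (hmean : ∀ i j, ∫ a, (a : ℝ) ∂(arr i j).toMeasure = lam i j)
    (W : Submodule ℝ (MatrixSpace n)) :
    ∫ a, ‖W.starProjection (natVec a - toVec lam)‖ ^ 2 ∂arrivalLaw arr =
      ∑ i, ∑ j, W.starProjection (EuclideanSpace.single (i, j) 1) (i, j) *
        Var[fun a : ℕ => (a : ℝ); (arr i j).toMeasure] := by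
  have hLp (e : Fin n × Fin n) : MemLp (fun a => natVec a e) 2 (arrivalLaw arr) :=
    memLp_arrivalLaw_apply harr e.1 e.2
  have hvar (i j : Fin n) : Var[fun a => natVec a (i, j); arrivalLaw arr] =
      Var[fun a : ℕ => (a : ℝ); (arr i j).toMeasure] := by
    have hlaw := hasLaw_arrivalLaw_apply arr i j
    rw [← hlaw.map_eq, variance_map Measurable.of_discrete.aemeasurable hlaw.aemeasurable]
    rfl
  simp only [← hvar, ← Fintype.sum_prod_type']
  refine integral_sq_norm_starProjection W hLp (fun e => ?_) fun e f hef => ?_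
  · exact ((hasLaw_arrivalLaw_apply arr e.1 e.2).integral_comp
      Measurable.of_discrete.aestronglyMeasurable).trans (hmean e.1 e.2)
  · have hind := (iIndepFun_arrivalLaw arr).indepFun hef
    exact (hind.comp (φ := fun k : ℕ => (k : ℝ)) (ψ := fun k : ℕ => (k : ℝ)) Measurable.of_discrete
      Measurable.of_discrete).covariance_eq_zero (hLp e) (hLp f)

variable {lam : Fin n → Fin n → ℝ} in
lemma SaturatesExactly.memLp_natVec (hlam : SaturatesExactly ∅ ∅ lam)
    {arr : Fin n → Fin n → PMF ℕ}
    (harr : ∀ i j, ∀ a ∈ (arr i j).support, a ≤ b)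
    (hmean : ∀ i j, ∫ a, (a : ℝ) ∂(arr i j).toMeasure = lam i j)
    {rule : QueueState n → PMF (Equiv.Perm (Fin n))} (hrule : IsMaxWeightRule rule)
    {μ : Measure (QueueState n)} [IsProbabilityMeasure μ]
    (hμ : Kernel.Invariant (queueKernel arr rule) μ) : MemLp natVec 2 μ := by
  obtain ⟨Ω, _, P, _, Q, A, S, hQ, -, h⟩ := exists_isStationarySwitch harr hmean hrule hμ
  rw [← hQ.map_eq]
  exact (memLp_map_measure_iff Measurable.of_discrete.aestronglyMeasurable hQ.aemeasurable).2
    (h.memLp_natVec_queue hlam)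

theorem SaturatesExactly.exists_forall_heavyTraffic_le (hν : SaturatesExactly R C ν) (b : ℕ) :
    ∃ ε₀ ∈ Set.Ioo (0 : ℝ) 1, ∃ K, ∀ ε ∈ Set.Ioc 0 ε₀,
      ∀ (arr : Fin n → Fin n → PMF ℕ) (rule) (μ : Measure (QueueState n)) [IsProbabilityMeasure μ],
      (∀ i j, ∀ a ∈ (arr i j).support, a ≤ b) →
      (∀ i j, ∫ a, (a : ℝ) ∂(arr i j).toMeasure = (1 - ε) * ν i j) →
      IsMaxWeightRule rule → Kernel.Invariant (queueKernel arr rule) μ →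
      |ε * ∫ q, ∑ i, ∑ j, (q i j : ℝ) ∂μ - n / 2 * ∑ i, ∑ j,
          (portSpace R C).starProjection (EuclideanSpace.single (i, j) 1) (i, j) *
            Var[fun a : ℕ => (a : ℝ); (arr i j).toMeasure]| ≤ K * √ε ∧
        ∀ i ∉ R, ∀ j ∉ C, |ε * ∫ q, (q i j : ℝ) ∂μ| ≤ K * √ε := by
  obtain ⟨δ, hδ, hdrift⟩ := hν.exists_inner_coneProj_sub_le
  obtain ⟨ε₀, hε₀, hε₀δ⟩ : ∃ ε₀ ∈ Set.Ioo (0 : ℝ) 1, ε₀ * ‖toVec ν‖ ≤ δ / 2 := by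
    have htend : Tendsto (fun ε : ℝ => ε * ‖toVec ν‖) (𝓝[>] 0) (𝓝 0) := by
      simpa using (tendsto_id.mul_const ‖toVec ν‖).mono_left (nhdsWithin_le_nhds (a := (0 : ℝ)))
    exact (Eventually.and (Ioo_mem_nhdsGT one_pos) (htend.eventually_le_const (half_pos hδ))).exists
  set M := 1 + collapseBound n b δ
  set K := n * M + n / 2 * (‖(portSpace R C).starProjection (toVec ν)‖ ^ 2 + M +
    (2 * (n : ℝ) ^ 2 + n) * inner ℝ (portCount R C) (toVec ν))
  refine ⟨ε₀, hε₀, max K M, fun ε hε arr rule μ _ harr hmean hrule hμ => ?_⟩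
  obtain ⟨Ω, _, P, _, Q, A, S, hQ, hA, h⟩ := exists_isStationarySwitch harr hmean hrule hμ
  have hQ₂ := h.memLp_natVec_queue (hν.one_sub_mul hε.1 (hε.2.trans_lt hε₀.2))
  have hεν : ε * ‖toVec ν‖ ≤ δ / 2 := le_trans (by gcongr; exact hε.2) hε₀δ
  obtain ⟨hp₁, hM₁⟩ := h.integral_norm_coneProj_pow_le hdrift hδ hε.1.le hεν
    (by norm_num : 1 ≤ 3)
  obtain ⟨hp₂, hM₂⟩ := h.integral_norm_coneProj_pow_le hdrift hδ hε.1.le hεν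
    (by norm_num : 2 ≤ 3)
  simp only [pow_one] at hp₁ hM₁
  constructor
  · rw [← integral_sq_norm_starProjection_arrivalLaw harr hmean,
      ← hA.integral_comp Measurable.of_discrete.aestronglyMeasurable,
      ← hQ.integral_comp Measurable.of_discrete.aestronglyMeasurable]
    refine (h.abs_mul_integral_sum_sub_le hν hQ₂ hε.1 (hε.2.trans hε₀.2.le) hp₁ hM₁ hp₂
      hM₂).trans ?_
    gcongr
    exact le_max_left _ _
  · intro i hi j hj
    rw [← hQ.integral_comp Measurable.of_discrete.aestronglyMeasurable]
    have hle : ∫ ω, (Q ω i j : ℝ) ∂P ≤ max K M :=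
      ((integral_queue_apply_le hQ₂ hp₁ hi hj).trans hM₁).trans (le_max_right K M)
    have hnonneg : 0 ≤ ∫ ω, (Q ω i j : ℝ) ∂P := integral_nonneg fun ω => Nat.cast_nonneg _
    calc |ε * ∫ ω, (Q ω i j : ℝ) ∂P| = (∫ ω, (Q ω i j : ℝ) ∂P) * ε := by
          rw [abs_of_nonneg (mul_nonneg hε.1.le hnonneg), mul_comm]
      _ ≤ max K M * √ε := mul_le_mul hle (Real.le_sqrt_of_sq_le (by nlinarith [hε.1, hε.2, hε₀.2]))
        hε.1.le (hnonneg.trans hle)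

end StationaryDistribution

lemma tendsto_of_abs_sub_le_mul_sqrt {f g : ℝ → ℝ} {K ε₀ c : ℝ} (hε₀ : 0 < ε₀)
    (hfg : ∀ ε ∈ Set.Ioc 0 ε₀, |f ε - g ε| ≤ K * √ε) (hg : Tendsto g (𝓝[>] 0) (𝓝 c)) :
    Tendsto f (𝓝[>] 0) (𝓝 c) := by
  have hsqrt : Tendsto (fun ε => K * √ε) (𝓝[>] 0) (𝓝 0) := by
    have h : Continuous fun ε => K * √ε := by fun_prop
    simpa using (h.tendsto 0).mono_left nhdsWithin_le_nhds
  have hzero : Tendsto (fun ε => f ε - g ε) (𝓝[>] 0) (𝓝 0) :=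
    squeeze_zero_norm' (by filter_upwards [Ioc_mem_nhdsGT hε₀] using hfg) hsqrt
  simpa using hzero.add hg

lemma div_two_mul_sum_starProjection_single {n n₁ n₂ : ℕ} (hn₁ : n₁ < n) (hn₂ : n₂ < n)
    (v : Fin n → Fin n → ℝ) :
    n / 2 * ∑ i, ∑ j, (portSpace (firstPorts n n₁) (firstPorts n n₂)).starProjection
        (EuclideanSpace.single (i, j) 1) (i, j) * v i j =
      1 / 2 * ∑ i, ∑ j, v i j * zetaWeight n n₁ n₂ i j := by
  simp only [← mul_starProjection_single_eq_zetaWeight hn₁ hn₂, Finset.mul_sum]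
  congr! 2 with i _ j _
  ring

theorem mainTheorem6 {n n₁ n₂ : ℕ} (hn₁ : n₁ < n) (hn₂ : n₂ < n)
    (ν : Fin n → Fin n → ℝ)
    (hν : ν ∈ intrinsicInterior ℝ (saturatedFace n n₁ n₂))
    (hνpos : ∀ i j, 0 < ν i j)
    (aMax : ℕ)
    (arr : ℝ → Fin n → Fin n → PMF ℕ)
    (harr : ∀ ε ∈ Set.Ioo (0 : ℝ) 1, ∀ i j, ∀ a ∈ (arr ε i j).support, a ≤ aMax)
    (hmean : ∀ ε ∈ Set.Ioo (0 : ℝ) 1, ∀ i j,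
      ∫ a, (a : ℝ) ∂(arr ε i j).toMeasure = (1 - ε) * ν i j)
    (σ : Fin n → Fin n → ℝ)
    (hvar : ∀ i j,
      Tendsto (fun ε : ℝ => variance (fun a : ℕ => (a : ℝ)) (arr ε i j).toMeasure)
        (𝓝[>] 0) (𝓝 (σ i j ^ 2)))
    (rule : ℝ → QueueState n → PMF (Equiv.Perm (Fin n)))
    (hrule : ∀ ε ∈ Set.Ioo (0 : ℝ) 1, IsMaxWeightRule (rule ε))
    (steady : ℝ → ProbabilityMeasure (QueueState n))
    (hsteady : ∀ ε ∈ Set.Ioo (0 : ℝ) 1,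
      Kernel.Invariant (queueKernel (arr ε) (rule ε)) (steady ε : Measure (QueueState n))) :
    (∀ ε ∈ Set.Ioo (0 : ℝ) 1, ∀ i j,
      Integrable (fun q : QueueState n => (q i j : ℝ)) (steady ε : Measure (QueueState n))) ∧
    Tendsto
      (fun ε : ℝ => ε * ∫ q, (∑ i, ∑ j, (q i j : ℝ)) ∂(steady ε : Measure (QueueState n)))
      (𝓝[>] 0) (𝓝 (1 / 2 * ∑ i, ∑ j, σ i j ^ 2 * zetaWeight n n₁ n₂ i j)) ∧
    (∀ i j : Fin n, n₁ ≤ (i : ℕ) → n₂ ≤ (j : ℕ) →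
      Tendsto (fun ε : ℝ => ε * ∫ q, (q i j : ℝ) ∂(steady ε : Measure (QueueState n)))
        (𝓝[>] 0) (𝓝 0)) := by
  have hsat := saturatesExactly_of_mem_intrinsicInterior hn₁ hn₂ hν hνpos
  obtain ⟨ε₀, hε₀, K, hK⟩ := hsat.exists_forall_heavyTraffic_le aMax
  have hε₀_sub : Set.Ioc 0 ε₀ ⊆ Set.Ioo 0 1 := fun ε hε => ⟨hε.1, hε.2.trans_lt hε₀.2⟩
  have hrate (ε) (hε : ε ∈ Set.Ioc 0 ε₀) :=
    have hε' := hε₀_sub hε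
    hK ε hε (arr ε) (rule ε) (steady ε) (harr ε hε') (hmean ε hε') (hrule ε hε') (hsteady ε hε')
  simp only [div_two_mul_sum_starProjection_single hn₁ hn₂] at hrate
  refine ⟨fun ε hε i j => ?_, ?_, fun i j hi hj => ?_⟩
  · exact integrable_queue_apply ((hsat.one_sub_mul hε.1 hε.2).memLp_natVec (harr ε hε)
      (hmean ε hε) (hrule ε hε) (hsteady ε hε)) i j
  · exact tendsto_of_abs_sub_le_mul_sqrt hε₀.1 (fun ε hε => (hrate ε hε).1)
      ((tendsto_finsetSum _ fun i _ => tendsto_finsetSum _ fun j _ =>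
        (hvar i j).mul_const _).const_mul _)
  · refine tendsto_of_abs_sub_le_mul_sqrt (K := K) hε₀.1 (fun ε hε => ?_) tendsto_const_nhds
    rw [sub_zero]
    exact (hrate ε hε).2 i (by simpa [mem_firstPorts] using hi) j
      (by simpa [mem_firstPorts] using hj)
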